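/- Let $d\ge 3$. For a finite set $P\subset\mathbb{R}^d$, call two noncollinear triples of points of $P$ equivalent if some isometry of $\mathbb{R}^d$ maps the three points of one onto the three points of the other (in any order), and let $T(P)$ be the set of equivalence classes, i.e. the set of distinct triangles determined by $P$. Then $2d$ is the maximum of $|P|$ over all finite sets $P\subset\mathbb{R}^d$ with $|T(P)|=2$. Moreover, the vertex set of the regular $d$-orthoplex is, up to similarity, the unique configuration attaining this maximum: a finite set $P\subset\mathbb{R}^d$ satisfies $|P|=2d$ and $|T(P)|=2$ if and only if $P$ is the image of $\{\pm e_1,\dots,\pm e_d\}$ under a similarity of $\mathbb{R}^d$, where $e_1,\dots,e_d$ is the standard basis. -/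

import Mathlib

namespace TwoTriangles

/-- The noncollinear triples `(a, b, c) ∈ P³` of a finite point set `P` in `ℝ^d`. -/
def NoncollinearTriple {d : ℕ} (P : Finset (EuclideanSpace ℝ (Fin d))) : Type :=
  {t : Fin 3 → EuclideanSpace ℝ (Fin d) // (∀ i, t i ∈ P) ∧ ¬ Collinear ℝ (Set.range t)}

/-- Two triples are equivalent if some isometry of `ℝ^d` maps the three points of one onto the
three points of the other (as a triangle, so the order in which the vertices are listed does not
matter). -/
def Congr {d : ℕ} (s t : Fin 3 → EuclideanSpace ℝ (Fin d)) : Prop :=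
  ∃ φ : EuclideanSpace ℝ (Fin d) ≃ᵢ EuclideanSpace ℝ (Fin d),
    φ '' Set.range s = Set.range t

theorem Congr.refl {d : ℕ} (s : Fin 3 → EuclideanSpace ℝ (Fin d)) : Congr s s :=
  ⟨IsometryEquiv.refl _, Set.image_id _⟩

theorem Congr.symm {d : ℕ} {s t : Fin 3 → EuclideanSpace ℝ (Fin d)} (h : Congr s t) :
    Congr t s := by
  obtain ⟨φ, hφ⟩ := h
  refine ⟨φ.symm, ?_⟩
  rw [← hφ, Set.image_image]
  simp

theorem Congr.trans {d : ℕ} {s t u : Fin 3 → EuclideanSpace ℝ (Fin d)} (h : Congr s t)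
    (h' : Congr t u) : Congr s u := by
  obtain ⟨φ, hφ⟩ := h
  obtain ⟨ψ, hψ⟩ := h'
  refine ⟨φ.trans ψ, ?_⟩
  rw [← hψ, ← hφ, Set.image_image]
  rfl

/-- Equivalence of noncollinear triples of `P`. -/
def tripleSetoid {d : ℕ} (P : Finset (EuclideanSpace ℝ (Fin d))) :
    Setoid (NoncollinearTriple P) where
  r s t := Congr s.1 t.1
  iseqv := ⟨fun s => Congr.refl s.1, fun h => Congr.symm h, fun h h' => Congr.trans h h'⟩

/-- The set `T(P)` of distinct triangles determined by `P`. -/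
def DistinctTriangles {d : ℕ} (P : Finset (EuclideanSpace ℝ (Fin d))) : Type :=
  Quotient (tripleSetoid P)

/-- The number of distinct triangles determined by `P`. -/
noncomputable def numTriangles {d : ℕ} (P : Finset (EuclideanSpace ℝ (Fin d))) : ℕ :=
  Nat.card (DistinctTriangles P)

/-- The vertices `±e₁, …, ±e_d` of the standard regular `d`-orthoplex. -/
def stdOrthoplex (d : ℕ) : Set (EuclideanSpace ℝ (Fin d)) :=
  {x | ∃ i : Fin d, x = EuclideanSpace.single i 1 ∨ x = EuclideanSpace.single i (-1)}

/-- `P` is the vertex set of a regular `d`-orthoplex: the image of the standard one under a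
similarity of `ℝ^d`. -/
def IsOrthoplex {d : ℕ} (P : Finset (EuclideanSpace ℝ (Fin d))) : Prop :=
  ∃ f : EuclideanSpace ℝ (Fin d) ≃ᵈ EuclideanSpace ℝ (Fin d),
    (P : Set (EuclideanSpace ℝ (Fin d))) = f '' stdOrthoplex d

end TwoTriangles

/-!
Assign to a triangle the multiset of its squared side lengths (`sides`); congruent triangles have
equal multisets. Let `P` have at least `2 * d ≥ 6` points and two triangle classes.

*No three points of `P` are collinear* (`HasSides.gram_ne_zero`). If `y` lies between `x` and `z`,
and `w` is off their line, then comparing the areas of `xyw`, `yzw`, `xzw` shows that `xyw` and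
`yzw` are congruent, so `y` is the midpoint of `xz` and `w` lies on the perpendicular bisector.
This excludes a fourth point on the line, fixes the two classes, and forces any two points off the
line to be opposite with respect to `y`; so there are at most five points.

*Colouring.* Hence the distances colour the edges of the complete graph on `P` so that all
triangles show at most two colour patterns. By a pigeonhole argument on five edges at a vertex, a
monochromatic triangle exists (`exists_mono_triangle`), and then `colouring_classification` leaves
two cases: all edges have colour `a` up to a matching of colour `b`, or there are at most two
cliques of colour `a` with all cross edges of colour `b`.

*Dimension.* For coefficients `c` of sum zero,
`∑ c x * c y * ‖x - y‖ ^ 2 = -2 * ‖∑ c x • x‖ ^ 2`. Two cliques therefore have at most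
`d + 2 < 2 * d` points. In the matching case let `A`, `B` be the squared distances. If `B < 2 * A`,
the points are affinely independent; if `B > 2 * A`, two disjoint matching edges give a vector of
negative squared norm. So `B = 2 * A`, and seen from the midpoint of a matching edge any two points
are orthogonal or opposite (`IsCross`). Such a configuration has at most `2 * d` points, with
equality only for an orthoplex (`IsCross.card_le`).

Conversely, orthonormal systems of equal size are related by linear isometries, so the orthoplex has
exactly two classes of triangles (`numTriangles_of_isOrthoplex`).
-/

namespace TwoTriangles

open Module
open scoped RealInnerProductSpace

/-! ### Side lengths, areas, and collinear triples -/

section InnerProduct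
variable {E : Type*} [NormedAddCommGroup E] [InnerProductSpace ℝ E]

/-- The multiset of squared side lengths of the triangle `x y z`. -/
noncomputable def sides (x y z : E) : Multiset ℝ :=
  {‖x - y‖ ^ 2, ‖y - z‖ ^ 2, ‖x - z‖ ^ 2}

/-- The Gram determinant of two vectors; for `v = y - x` and `w = z - x` it is four times the
squared area of the triangle `x y z`. -/
noncomputable def gram (v w : E) : ℝ := ‖v‖ ^ 2 * ‖w‖ ^ 2 - ⟪v, w⟫ ^ 2

theorem triple_eq {α : Type*} {a b c a' b' c' : α}
    (h : ({a, b, c} : Multiset α) = {a', b', c'}) :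
    (a = a' ∧ b = b' ∧ c = c') ∨ (a = a' ∧ b = c' ∧ c = b') ∨ (a = b' ∧ b = a' ∧ c = c') ∨
      (a = b' ∧ b = c' ∧ c = a') ∨ (a = c' ∧ b = a' ∧ c = b') ∨ (a = c' ∧ b = b' ∧ c = a') := by
  classical
  simp only [Multiset.insert_eq_cons, Multiset.cons_eq_cons, Multiset.singleton_eq_cons_iff,
    Multiset.singleton_inj] at h
  grind [Multiset.cons_zero, Multiset.singleton_inj]

theorem triple_sum {a b c a' b' c' : ℝ} (h : ({a, b, c} : Multiset ℝ) = {a', b', c'}) :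
    a + b + c = a' + b' + c' := by
  rcases triple_eq h with h | h | h | h | h | h <;> obtain ⟨rfl, rfl, rfl⟩ := h <;> ring

theorem gram_eq_sides (x y z : E) : gram (y - x) (z - x) =
    ((‖x - y‖ ^ 2 + ‖y - z‖ ^ 2 + ‖x - z‖ ^ 2) ^ 2 -
      2 * ((‖x - y‖ ^ 2) ^ 2 + (‖y - z‖ ^ 2) ^ 2 + (‖x - z‖ ^ 2) ^ 2)) / 4 := by
  have h : ‖y - z‖ ^ 2 = ‖y - x‖ ^ 2 - 2 * ⟪y - x, z - x⟫ + ‖z - x‖ ^ 2 := by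
    rw [← norm_sub_sq_real]; congr 2; abel
  rw [h, norm_sub_rev x y, norm_sub_rev x z, gram]
  ring

theorem gram_eq_of_sides_eq {x y z x' y' z' : E} (h : sides x y z = sides x' y' z') :
    gram (y - x) (z - x) = gram (y' - x') (z' - x') := by
  rw [gram_eq_sides, gram_eq_sides]
  rcases triple_eq h with h | h | h | h | h | h <;> obtain ⟨h1, h2, h3⟩ := h <;>
    rw [h1, h2, h3] <;> ring

theorem gram_smul_left (r : ℝ) (v w : E) : gram (r • v) w = r ^ 2 * gram v w := by
  simp only [gram, norm_smul, real_inner_smul_left, mul_pow, Real.norm_eq_abs, sq_abs]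
  ring

theorem gram_add_smul (r : ℝ) (v w : E) : gram v (w + r • v) = gram v w := by
  have h : ‖w + r • v‖ ^ 2 = ‖w‖ ^ 2 + 2 * (r * ⟪v, w⟫) + r ^ 2 * ‖v‖ ^ 2 := by
    rw [norm_add_sq_real, real_inner_smul_right, norm_smul, mul_pow, Real.norm_eq_abs, sq_abs,
      real_inner_comm]
  simp only [gram, h, inner_add_right, real_inner_smul_right, real_inner_self_eq_norm_sq]
  ring

theorem exists_smul_of_gram_eq_zero {v w : E} (hv : v ≠ 0) (h : gram v w = 0) :
    ∃ r : ℝ, w = r • v := by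
  have hv' : ‖v‖ ^ 2 ≠ 0 := by positivity
  have hn : ‖‖v‖ ^ 2 • w - ⟪v, w⟫ • v‖ ^ 2 = ‖v‖ ^ 2 * gram v w := by
    rw [norm_sub_sq_real, norm_smul, norm_smul, real_inner_smul_left, real_inner_smul_right,
      mul_pow, mul_pow, real_inner_comm v w, gram]
    simp only [Real.norm_eq_abs, sq_abs]
    ring
  rw [h, mul_zero, sq_eq_zero_iff, norm_eq_zero, sub_eq_zero] at hn
  refine ⟨(‖v‖ ^ 2)⁻¹ * ⟪v, w⟫, ?_⟩
  rw [mul_smul, ← hn, smul_smul, inv_mul_cancel₀ hv', one_smul]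

theorem collinear_of_gram_eq_zero {x y z : E} (h : gram (y - x) (z - x) = 0) :
    Collinear ℝ {x, y, z} := by
  by_cases hv : y - x = 0
  · rw [sub_eq_zero] at hv
    subst hv
    simpa using collinear_pair ℝ y z
  · obtain ⟨r, hr⟩ := exists_smul_of_gram_eq_zero hv h
    rw [collinear_iff_of_mem (p₀ := x) (by simp)]
    refine ⟨y - x, ?_⟩
    rintro p (rfl | rfl | rfl)
    · exact ⟨0, by simp⟩
    · exact ⟨1, by simp⟩
    · exact ⟨r, by simp [← hr]⟩

theorem gram_eq_zero_of_collinear {x y z : E} (h : Collinear ℝ {x, y, z}) :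
    gram (y - x) (z - x) = 0 := by
  rw [collinear_iff_of_mem (p₀ := x) (by simp)] at h
  obtain ⟨v, hv⟩ := h
  obtain ⟨r, rfl⟩ := hv y (by simp)
  obtain ⟨s, rfl⟩ := hv z (by simp)
  simp only [vadd_eq_add, add_sub_cancel_right, gram, norm_smul, real_inner_smul_left,
    real_inner_smul_right, mul_pow, Real.norm_eq_abs, sq_abs, real_inner_self_eq_norm_sq]
  ring

/-- All nondegenerate triangles with vertices in `P` have one of the two multisets `T₁`, `T₂` of
squared side lengths. -/
def HasSides (P : Finset E) (T₁ T₂ : Multiset ℝ) : Prop :=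
  ∀ x ∈ P, ∀ y ∈ P, ∀ z ∈ P, gram (y - x) (z - x) ≠ 0 → sides x y z = T₁ ∨ sides x y z = T₂

variable {P : Finset E} {T₁ T₂ : Multiset ℝ}

/-- If `y` lies strictly between two other points of `P` and `w` is off their line, then the two
small triangles have smaller area than the large one, so they are congruent: `y` is the midpoint,
and `w` lies on the perpendicular bisector. -/
theorem HasSides.midpoint_perp (h : HasSides P T₁ T₂) {y a u : E} {r : ℝ} (hr : 0 < r)
    (hx : y - a ∈ P) (hy : y ∈ P) (hz : y + r • a ∈ P) (hw : y + u ∈ P) (hg : gram a u ≠ 0) :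
    r = 1 ∧ ⟪a, u⟫ = 0 := by
  have g1 : gram (y - (y - a)) (y + u - (y - a)) = gram a u := by
    rw [← gram_add_smul 1 a u]; congr 1
    · abel
    · rw [one_smul]; abel
  have g2 : gram (y + r • a - y) (y + u - y) = r ^ 2 * gram a u := by
    rw [add_sub_cancel_left, add_sub_cancel_left, gram_smul_left]
  have g3 : gram (y + r • a - (y - a)) (y + u - (y - a)) = (1 + r) ^ 2 * gram a u := by
    rw [← gram_add_smul 1 a u, ← gram_smul_left]; congr 1
    · rw [add_smul, one_smul]; abel
    · rw [one_smul]; abel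
  have n12 : sides (y - a) y (y + u) ≠ sides (y - a) (y + r • a) (y + u) := by
    intro e
    have := gram_eq_of_sides_eq e
    rw [g1, g3] at this
    have : (1 + r) ^ 2 = 1 := mul_right_cancel₀ hg (by linarith)
    nlinarith
  have n23 : sides y (y + r • a) (y + u) ≠ sides (y - a) (y + r • a) (y + u) := by
    intro e
    have := gram_eq_of_sides_eq e
    rw [g2, g3] at this
    have : (1 + r) ^ 2 = r ^ 2 := mul_right_cancel₀ hg (by linarith)
    nlinarith
  have e : sides (y - a) y (y + u) = sides y (y + r • a) (y + u) := by
    have h1 := h _ hx _ hy _ hw (by rwa [g1])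
    have h2 := h _ hy _ hz _ hw (by rw [g2]; positivity)
    have h3 := h _ hx _ hz _ hw (by rw [g3]; positivity)
    grind
  have hr1 : r = 1 := by
    have := gram_eq_of_sides_eq e
    rw [g1, g2] at this
    have : r ^ 2 = 1 := mul_right_cancel₀ hg (by linarith)
    nlinarith
  subst hr1
  refine ⟨rfl, ?_⟩
  have := triple_sum e
  have e1 : y - a - y = -a := by abel
  have e2 : y - (y + u) = -u := by abel
  have e3 : y - a - (y + u) = -(a + u) := by abel
  have e4 : y - (y + (1 : ℝ) • a) = -a := by rw [one_smul]; abel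
  have e5 : y + (1 : ℝ) • a - (y + u) = a - u := by rw [one_smul]; abel
  rw [e1, e2, e3, e4, e5, norm_neg, norm_neg, norm_neg, norm_add_sq_real, norm_sub_sq_real] at this
  linarith

/-- With `w = y + u` off the line through `y - a, y, y + a`, no further point of `P` lies on
that line: `w` would have to project orthogonally onto two different points. -/
theorem HasSides.smul_notMem (h : HasSides P T₁ T₂) {y a u : E} {r : ℝ}
    (hx : y - a ∈ P) (hy : y ∈ P) (hz : y + a ∈ P) (hw : y + u ∈ P) (hg : gram a u ≠ 0)
    (hr0 : r ≠ 0) (hr1 : r ≠ 1) (hr2 : r ≠ -1) : y + r • a ∉ P := by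
  intro hp
  have ha : a ≠ 0 := by rintro rfl; simp [gram] at hg
  have hau : ⟪a, u⟫ = 0 :=
    (h.midpoint_perp one_pos hx hy (by rwa [one_smul]) hw hg).2
  have hn : 0 < ‖a‖ ^ 2 := by positivity
  -- The middle one of three points, not equal to `y`, is `y + m • a`, with neighbours
  -- `y + (m - l) • a` and `y + (m + k * l) • a`.
  have key : ∀ m l k : ℝ, l ≠ 0 → 0 < k → m ≠ 0 → y + (m - l) • a ∈ P → y + m • a ∈ P →
      y + (m + k * l) • a ∈ P → False := by
    intro m l k hl hk hm h1 h2 h3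
    have := (h.midpoint_perp (y := y + m • a) (a := l • a) (u := u - m • a) (r := k) hk
      (by convert h1 using 1; module) h2 (by convert h3 using 1; module)
      (by convert hw using 1; module) (by
        rw [gram_smul_left, sub_eq_add_neg, ← neg_smul, gram_add_smul]; positivity)).2
    rw [real_inner_smul_left, inner_sub_right, real_inner_smul_right, hau,
      real_inner_self_eq_norm_sq] at this
    have h0 : l * (m * ‖a‖ ^ 2) = 0 := by linarith
    have : l * (m * ‖a‖ ^ 2) ≠ 0 := by positivity
    exact this h0
  rcases lt_or_gt_of_ne hr0 with hr | hr
  · rcases lt_or_gt_of_ne hr2 with hr' | hr'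
    · refine key (-1) (-1 - r) (1 / (-1 - r)) (by linarith) (by apply one_div_pos.2; linarith)
        (by norm_num) ?_ ?_ ?_
      · convert hp using 3; ring
      · convert hx using 1; module
      · have : (-1 : ℝ) - r ≠ 0 := by linarith
        rw [one_div_mul_cancel this]; convert hy using 1; module
    · refine key r (r + 1) (-r / (r + 1)) (by linarith) (by apply div_pos <;> linarith) hr0 ?_ hp ?_
      · convert hx using 1; module
      · have : r + 1 ≠ 0 := by linarith
        rw [div_mul_cancel₀ _ this]; convert hy using 1; module
  · rcases lt_or_gt_of_ne hr1 with hr' | hr'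
    · refine key r r ((1 - r) / r) hr0 (by apply div_pos <;> linarith) hr0 ?_ hp ?_
      · convert hy using 1; module
      · rw [div_mul_cancel₀ _ hr0]; convert hz using 1; module
    · refine key 1 1 (r - 1) one_ne_zero (by linarith) one_ne_zero ?_ ?_ ?_
      · convert hy using 1; module
      · convert hz using 1; module
      · convert hp using 3; ring

theorem exists_middle {x y z : E} (hx : x ∈ P) (hy : y ∈ P) (hz : z ∈ P) (hxy : x ≠ y)
    (hyz : y ≠ z) (hxz : x ≠ z) (h : gram (y - x) (z - x) = 0) :
    ∃ (m a : E) (r : ℝ), 0 < r ∧ a ≠ 0 ∧ m ∈ P ∧ m - a ∈ P ∧ m + r • a ∈ P := by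
  obtain ⟨s, hs⟩ := exists_smul_of_gram_eq_zero (sub_ne_zero.2 hxy.symm) h
  obtain ⟨v, rfl⟩ : ∃ v, y = x + v := ⟨y - x, by abel⟩
  rw [add_sub_cancel_left] at hs
  obtain rfl : z = x + s • v := by rw [← hs]; abel
  have hv : v ≠ 0 := by rintro rfl; simp at hxy
  have hs0 : s ≠ 0 := by rintro rfl; simp at hxz
  have hs1 : s ≠ 1 := by rintro rfl; simp at hyz
  rcases lt_or_gt_of_ne hs0 with h0 | h0
  · refine ⟨x, -v, -s, by linarith, neg_ne_zero.2 hv, hx, ?_, ?_⟩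
    · convert hy using 1; module
    · convert hz using 1; module
  · rcases lt_or_gt_of_ne hs1 with h1 | h1
    · refine ⟨x + s • v, s • v, (1 - s) / s, by apply div_pos <;> linarith,
        smul_ne_zero hs0 hv, hz, ?_, ?_⟩
      · convert hx using 1; module
      · rw [smul_smul, div_mul_cancel₀ _ hs0]; convert hy using 1; module
    · refine ⟨x + v, v, s - 1, by linarith, hv, hy, ?_, ?_⟩
      · convert hx using 1; module
      · convert hz using 1; module

/-- Two points off the line through `m - a, m, m + a` are opposite to each other with respect to
`m`. All triangles formed by that line and a further point fall into the two classes of the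
right and the isosceles triangle; this fixes the distance to `m`, and leaves no class for a
nondegenerate triangle with vertices `m, m + u, m + u'`. -/
theorem HasSides.eq_neg (h : HasSides P T₁ T₂) {m a u u' : E}
    (hm : m ∈ P) (hx : m - a ∈ P) (hz : m + a ∈ P) (hu : m + u ∈ P) (hu' : m + u' ∈ P)
    (hgu : gram a u ≠ 0) (hgu' : gram a u' ≠ 0) (hne : u ≠ u') : u' = -u := by
  have ha : a ≠ 0 := by rintro rfl; simp [gram] at hgu
  have hu0 : u ≠ 0 := by rintro rfl; simp [gram] at hgu
  have hz1 : m + (1 : ℝ) • a ∈ P := by rwa [one_smul]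
  have hA : 0 < ‖a‖ ^ 2 := by positivity
  have hB : 0 < ‖u‖ ^ 2 := by positivity
  have hp := (h.midpoint_perp one_pos hx hm hz1 hu hgu).2
  have hp' := (h.midpoint_perp one_pos hx hm hz1 hu' hgu').2
  have n1 : ∀ v : E, ‖m - (m + v)‖ ^ 2 = ‖v‖ ^ 2 := fun v => by
    rw [sub_add_cancel_left, norm_neg]
  have n2 : ∀ v : E, ⟪a, v⟫ = 0 → ‖m + a - (m + v)‖ ^ 2 = ‖a‖ ^ 2 + ‖v‖ ^ 2 := fun v hv => by
    rw [add_sub_add_left_eq_sub, norm_sub_sq_real, hv]; ring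
  have n3 : ∀ v : E, ⟪a, v⟫ = 0 → ‖m - a - (m + v)‖ ^ 2 = ‖a‖ ^ 2 + ‖v‖ ^ 2 := fun v hv => by
    rw [show m - a - (m + v) = -(a + v) by abel, norm_neg, norm_add_sq_real, hv]; ring
  have n4 : ‖m - a - (m + a)‖ ^ 2 = 4 * ‖a‖ ^ 2 := by
    rw [show m - a - (m + a) = (-2 : ℝ) • a by module, norm_smul, mul_pow]; norm_num
  have right : ∀ v : E, ⟪a, v⟫ = 0 → sides m (m + a) (m + v) =
      {‖a‖ ^ 2, ‖a‖ ^ 2 + ‖v‖ ^ 2, ‖v‖ ^ 2} := fun v hv => by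
    rw [sides, n1, n1, n2 v hv]
  have isos : ∀ v : E, ⟪a, v⟫ = 0 → sides (m - a) (m + a) (m + v) =
      {4 * ‖a‖ ^ 2, ‖a‖ ^ 2 + ‖v‖ ^ 2, ‖a‖ ^ 2 + ‖v‖ ^ 2} := fun v hv => by
    rw [sides, n2 v hv, n3 v hv, n4]
  have gr : ∀ v : E, gram (m + a - m) (m + v - m) = gram a v := fun v => by
    rw [add_sub_cancel_left, add_sub_cancel_left]
  have gi : ∀ v : E, gram (m + a - (m - a)) (m + v - (m - a)) = 2 ^ 2 * gram a v := fun v => by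
    rw [← gram_add_smul 1 a v, ← gram_smul_left]; congr 1 <;> module
  have hne1 : sides m (m + a) (m + u) ≠ sides (m - a) (m + a) (m + u) := by
    rw [right u hp, isos u hp]
    intro e
    have := triple_sum e
    linarith
  have types : ∀ x ∈ P, ∀ y ∈ P, ∀ z ∈ P, gram (y - x) (z - x) ≠ 0 →
      sides x y z = {‖a‖ ^ 2, ‖a‖ ^ 2 + ‖u‖ ^ 2, ‖u‖ ^ 2} ∨
        sides x y z = {4 * ‖a‖ ^ 2, ‖a‖ ^ 2 + ‖u‖ ^ 2, ‖a‖ ^ 2 + ‖u‖ ^ 2} := by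
    intro x hx' y hy' z hz' hg
    rw [← right u hp, ← isos u hp]
    have h1 := h _ hm _ hz _ hu (by rwa [gr])
    have h2 := h _ hx _ hz _ hu (by rw [gi]; positivity)
    have h3 := h _ hx' _ hy' _ hz' hg
    grind
  have hBB : ‖u'‖ ^ 2 = ‖u‖ ^ 2 := by
    have h1 := types _ hm _ hz _ hu' (by rwa [gr])
    have h2 := types _ hx _ hz _ hu' (by rw [gi]; positivity)
    rw [right u' hp'] at h1
    rw [isos u' hp'] at h2
    rcases h1 with h1 | h1 <;> rcases h2 with h2 | h2 <;> have s1 := triple_sum h1 <;>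
      have s2 := triple_sum h2 <;> linarith
  have hD : ‖u - u'‖ ^ 2 = 4 * ‖a‖ ^ 2 := by
    have hg : gram (m + u - (m - a)) (m + u' - (m - a)) ≠ 0 := by
      intro hg
      have hua : u + a ≠ 0 := by
        intro h0
        rw [eq_neg_of_add_eq_zero_left h0, inner_neg_right, real_inner_self_eq_norm_sq] at hp
        linarith
      obtain ⟨s, hs⟩ := exists_smul_of_gram_eq_zero
        (by rwa [show m + u - (m - a) = u + a by abel]) hg
      rw [show m + u - (m - a) = u + a by abel, show m + u' - (m - a) = u' + a by abel] at hs
      have := congrArg (fun v => ⟪a, v⟫) hs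
      simp only [inner_add_right, real_inner_smul_right, hp, hp', real_inner_self_eq_norm_sq,
        zero_add] at this
      have hs1 : s = 1 := by
        have : (s - 1) * ‖a‖ ^ 2 = 0 := by linarith
        rcases mul_eq_zero.1 this with h | h <;> linarith
      subst hs1
      rw [one_smul] at hs
      exact hne (add_right_cancel hs).symm
    have h1 := types _ hx _ hu _ hu' hg
    rw [sides, n3 _ hp, n3 _ hp', hBB, add_sub_add_left_eq_sub] at h1
    rcases h1 with h1 | h1
    · rcases triple_eq h1 with h | h | h | h | h | h <;> linarith
    · have := triple_sum h1
      linarith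
  have hg : gram u u' = 0 := by
    by_contra hg
    have h1 := types _ hm _ hu _ hu' (by simpa using hg)
    rw [sides, n1, n1, hBB, add_sub_add_left_eq_sub, hD] at h1
    rcases h1 with h1 | h1 <;> have := triple_sum h1 <;> linarith
  obtain ⟨s, rfl⟩ := exists_smul_of_gram_eq_zero hu0 hg
  rw [norm_smul, mul_pow, Real.norm_eq_abs, sq_abs] at hBB
  have : s ^ 2 = 1 := mul_right_cancel₀ hB.ne' (by linarith)
  rcases (mul_self_eq_one_iff (a := s)).1 (by rwa [← sq]) with rfl | rfl
  · simp at hne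
  · simp

/-- At least six points with at most two triangle classes contain no collinear triple, unless
they all lie on one line. -/
theorem HasSides.gram_ne_zero (h : HasSides P T₁ T₂) (hP : 6 ≤ P.card)
    (hnd : ∃ x ∈ P, ∃ y ∈ P, ∃ z ∈ P, gram (y - x) (z - x) ≠ 0) {x y z : E} (hx : x ∈ P)
    (hy : y ∈ P) (hz : z ∈ P) (hxy : x ≠ y) (hyz : y ≠ z) (hxz : x ≠ z) :
    gram (y - x) (z - x) ≠ 0 := by
  classical
  intro h0
  obtain ⟨m, a, r, hr, ha, hm, hma, hmr⟩ := exists_middle hx hy hz hxy hyz hxz h0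
  obtain ⟨w, hw, hgw⟩ : ∃ w ∈ P, gram a (w - m) ≠ 0 := by
    by_contra! hall
    obtain ⟨x, hx, y, hy, z, hz, hg⟩ := hnd
    obtain ⟨s, hs⟩ := exists_smul_of_gram_eq_zero ha (hall x hx)
    obtain ⟨t, ht⟩ := exists_smul_of_gram_eq_zero ha (hall y hy)
    obtain ⟨q, hq⟩ := exists_smul_of_gram_eq_zero ha (hall z hz)
    apply hg
    have e1 : y - x = (t - s) • a := by rw [sub_smul, ← hs, ← ht]; abel
    have e2 : z - x = 0 + (q - s) • a := by rw [sub_smul, ← hs, ← hq]; abel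
    rw [e1, e2, gram_smul_left, gram_add_smul]
    simp [gram]
  have hmw : m + (w - m) ∈ P := by simpa using hw
  obtain ⟨rfl, -⟩ := h.midpoint_perp hr hma hm hmr hmw hgw
  rw [one_smul] at hmr
  have off : ∀ p ∈ P \ {m, m - a, m + a}, gram a (p - m) ≠ 0 := by
    intro p hp hg
    simp only [Finset.mem_sdiff, Finset.mem_insert, Finset.mem_singleton, not_or] at hp
    obtain ⟨hpP, p1, p2, p3⟩ := hp
    obtain ⟨s, hs⟩ := exists_smul_of_gram_eq_zero ha hg
    obtain rfl : p = m + s • a := by rw [← hs]; abel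
    refine h.smul_notMem hma hm hmr hmw hgw ?_ ?_ ?_ hpP
    · rintro rfl; simp at p1
    · rintro rfl; simp at p3
    · rintro rfl; apply p2; module
  have hc : 2 < (P \ {m, m - a, m + a}).card := by
    have h1 := Finset.le_card_sdiff {m, m - a, m + a} P
    have h2 := Finset.card_le_three (a := m) (b := m - a) (c := m + a)
    omega
  obtain ⟨p, hp, q, hq, s, hs, hpq, hps, hqs⟩ := Finset.two_lt_card.1 hc
  have opp : ∀ p ∈ P \ {m, m - a, m + a}, ∀ q ∈ P \ {m, m - a, m + a}, p ≠ q →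
      q - m = -(p - m) := by
    intro p hp q hq hpq
    refine h.eq_neg hm hma hmr ?_ ?_ (off p hp) (off q hq) (by simpa using hpq)
    · simpa using (Finset.mem_sdiff.1 hp).1
    · simpa using (Finset.mem_sdiff.1 hq).1
  exact hqs (sub_left_injective ((opp p hp q hq hpq).trans (opp p hp s hs hps).symm))

end InnerProduct

/-! ### Edge colourings with two kinds of triangles -/

section Colouring
variable {V C : Type*} {c : V → V → C}

/-- Without monochromatic triangles, no colour occurs three times at a vertex. -/
theorem not_three_equal (hs : ∀ x y, c x y = c y x) {T₁ T₂ : Multiset C}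
    (h : ∀ x y z, x ≠ y → y ≠ z → x ≠ z →
      ({c x y, c y z, c x z} : Multiset C) = T₁ ∨ ({c x y, c y z, c x z} : Multiset C) = T₂)
    (hm : ∀ x y z, x ≠ y → y ≠ z → x ≠ z → c x y = c y z → c y z = c x z → False)
    {v p q r : V} (hp : v ≠ p) (hq : v ≠ q) (hr : v ≠ r) (hpq : p ≠ q) (hqr : q ≠ r) (hpr : p ≠ r)
    (e₁ : c v p = c v q) (e₂ : c v q = c v r) : False := by
  -- If two opposite sides differ, both types contain the repeated colour, but the triangle of the
  -- three opposite sides does not.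
  have key : ∀ x y z : V, v ≠ x → v ≠ y → v ≠ z → x ≠ y → y ≠ z → x ≠ z → c v x = c v y →
      c v y = c v z → c x y = c y z := by
    intro x y z hx hy hz hxy hyz hxz e₁ e₂
    by_contra hne
    have n1 : ({c v x, c x y, c v y} : Multiset C) ≠ {c v y, c y z, c v z} := by
      intro e
      have := triple_eq e
      grind
    have h1 := h v x y hx hxy hy
    have h2 := h v y z hy hyz hz
    have h3 := h x y z hxy hyz hxz
    have m1 := hm v x y hx hxy hy
    have m2 := hm v y z hy hyz hz
    have m3 := hm v x z hx hxz hz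
    have n2 : ({c x y, c y z, c x z} : Multiset C) ≠ {c v x, c x y, c v y} := by
      intro e
      have := triple_eq e
      grind
    have n3 : ({c x y, c y z, c x z} : Multiset C) ≠ {c v y, c y z, c v z} := by
      intro e
      have := triple_eq e
      grind
    grind
  have k1 := key p q r hp hq hr hpq hqr hpr e₁ e₂
  have k2 := key q r p hq hr hp hqr hpr.symm hpq.symm e₂ (e₂.symm.trans e₁.symm)
  exact hm p q r hpq hqr hpr k1 (k2.trans (hs r p))

/-- Five colours, none occurring three times, include four different ones, or their multiplicities
are two, two and one. -/
theorem five_colours (k : Fin 5 → C)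
    (h : ∀ i j l, i ≠ j → j ≠ l → i ≠ l → k i = k j → k j ≠ k l) :
    (∃ i j l m, k i ≠ k j ∧ k i ≠ k l ∧ k i ≠ k m ∧ k j ≠ k l ∧ k j ≠ k m ∧ k l ≠ k m) ∨
      ∃ i i' j j' l, i ≠ i' ∧ j ≠ j' ∧ k i = k i' ∧ k j = k j' ∧ k i ≠ k j ∧ k j ≠ k l ∧
        k i ≠ k l := by
  have h012 := h 0 1 2 (by decide) (by decide) (by decide)
  have h013 := h 0 1 3 (by decide) (by decide) (by decide)
  have h014 := h 0 1 4 (by decide) (by decide) (by decide)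
  have h023 := h 0 2 3 (by decide) (by decide) (by decide)
  have h024 := h 0 2 4 (by decide) (by decide) (by decide)
  have h034 := h 0 3 4 (by decide) (by decide) (by decide)
  have h123 := h 1 2 3 (by decide) (by decide) (by decide)
  have h124 := h 1 2 4 (by decide) (by decide) (by decide)
  have h134 := h 1 3 4 (by decide) (by decide) (by decide)
  have h234 := h 2 3 4 (by decide) (by decide) (by decide)
  by_contra! hc
  obtain ⟨h1, h2⟩ := hc
  have a1 := h1 0 1 2 3
  have a2 := h1 0 1 2 4
  have a3 := h1 0 1 3 4
  have a4 := h1 0 2 3 4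
  have a5 := h1 1 2 3 4
  have b1 := h2 0 1 2 3 4 (by decide) (by decide)
  have b2 := h2 0 1 2 4 3 (by decide) (by decide)
  have b3 := h2 0 1 3 4 2 (by decide) (by decide)
  have b4 := h2 0 2 1 3 4 (by decide) (by decide)
  have b5 := h2 0 2 1 4 3 (by decide) (by decide)
  have b6 := h2 0 2 3 4 1 (by decide) (by decide)
  have b7 := h2 0 3 1 2 4 (by decide) (by decide)
  have b8 := h2 0 3 1 4 2 (by decide) (by decide)
  have b9 := h2 0 3 2 4 1 (by decide) (by decide)
  have c1 := h2 0 4 1 2 3 (by decide) (by decide)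
  have c2 := h2 0 4 1 3 2 (by decide) (by decide)
  have c3 := h2 0 4 2 3 1 (by decide) (by decide)
  have c4 := h2 1 2 3 4 0 (by decide) (by decide)
  have c5 := h2 1 3 2 4 0 (by decide) (by decide)
  have c6 := h2 1 4 2 3 0 (by decide) (by decide)
  clear h1 h2 h
  generalize k 0 = x₀ at *
  generalize k 1 = x₁ at *
  generalize k 2 = x₂ at *
  generalize k 3 = x₃ at *
  generalize k 4 = x₄ at *
  by_cases e₁ : x₀ = x₁ <;> by_cases e₂ : x₀ = x₂ <;> by_cases e₃ : x₀ = x₃ <;>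
    by_cases e₄ : x₁ = x₂ <;> by_cases e₅ : x₁ = x₃ <;> by_cases e₆ : x₂ = x₃ <;> grind

theorem not_two_doubles {T : Multiset C} (hT : T.card = 3) {a b : C} (hab : a ≠ b)
    (ha : ({a, a} : Multiset C) ≤ T) (hb : ({b, b} : Multiset C) ≤ T) : False := by
  classical
  obtain ⟨x, y, z, rfl⟩ := Multiset.card_eq_three.1 hT
  have h1 := Multiset.le_iff_count.1 ha a
  have h2 := Multiset.le_iff_count.1 hb b
  simp only [Multiset.insert_eq_cons, Multiset.count_cons, Multiset.count_singleton,
    if_true] at h1 h2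
  grind

theorem not_double_of_mem {T : Multiset C} (hT : T.card = 3) {a b d : C} (hab : a ≠ b)
    (hbd : b ≠ d) (had : a ≠ d) (ha : a ∈ T) (hb : b ∈ T) (hd : d ∈ T) (e : C) :
    ¬ ({e, e} : Multiset C) ≤ T := by
  classical
  intro he
  obtain ⟨x, y, z, rfl⟩ := Multiset.card_eq_three.1 hT
  have h1 := Multiset.le_iff_count.1 he e
  simp only [Multiset.insert_eq_cons, Multiset.count_cons, Multiset.count_singleton,
    if_true, Multiset.mem_cons, Multiset.mem_singleton] at h1 ha hb hd
  grind

/-- Each pair of edges at a vertex has its colours in one of the two triangle types. Two types of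
three colours each cannot cover all pairs from four different colours, nor all pairs from two
repeated colours and a third one. -/
theorem exists_mono_triangle [Fintype V] (hV : 6 ≤ Fintype.card V) (hs : ∀ x y, c x y = c y x)
    {T₁ T₂ : Multiset C} (hT₁ : T₁.card = 3) (hT₂ : T₂.card = 3)
    (h : ∀ x y z, x ≠ y → y ≠ z → x ≠ z →
      ({c x y, c y z, c x z} : Multiset C) = T₁ ∨ ({c x y, c y z, c x z} : Multiset C) = T₂) :
    ∃ x y z, x ≠ y ∧ y ≠ z ∧ x ≠ z ∧ c x y = c y z ∧ c y z = c x z := by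
  classical
  by_contra! hm
  obtain ⟨v⟩ : Nonempty V := Fintype.card_pos_iff.1 (by omega)
  obtain ⟨S, hS, hS5⟩ := Finset.exists_subset_card_eq (s := Finset.univ.erase v) (n := 5) (by
    rw [Finset.card_erase_of_mem (Finset.mem_univ v), Finset.card_univ]; omega)
  obtain ⟨f, hf, hv⟩ : ∃ f : Fin 5 → V, Function.Injective f ∧ ∀ i, v ≠ f i :=
    ⟨fun i => (S.equivFinOfCardEq hS5).symm i, fun i j hij =>
      (S.equivFinOfCardEq hS5).symm.injective (Subtype.ext hij), fun i =>
      (Finset.ne_of_mem_erase (hS ((S.equivFinOfCardEq hS5).symm i).2)).symm⟩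
  have cover : ∀ i j, i ≠ j → ({c v (f i), c v (f j)} : Multiset C) ≤ T₁ ∨
      ({c v (f i), c v (f j)} : Multiset C) ≤ T₂ := by
    intro i j hij
    have hle : ({c v (f i), c v (f j)} : Multiset C) ≤ {c v (f i), c (f i) (f j), c v (f j)} :=
      Multiset.cons_le_cons _ (Multiset.le_cons_self _ _)
    rcases h v (f i) (f j) (hv i) (hf.ne hij) (hv j) with h | h <;> rw [h] at hle <;> tauto
  have sub : ∀ i j, c v (f i) ≠ c v (f j) → (c v (f i) ∈ T₁ ∧ c v (f j) ∈ T₁) ∨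
      (c v (f i) ∈ T₂ ∧ c v (f j) ∈ T₂) := by
    intro i j hij
    rcases cover i j (by rintro rfl; exact hij rfl) with h | h
    · exact Or.inl ⟨Multiset.mem_of_le h (by simp), Multiset.mem_of_le h (by simp)⟩
    · exact Or.inr ⟨Multiset.mem_of_le h (by simp), Multiset.mem_of_le h (by simp)⟩
  rcases five_colours (fun i => c v (f i)) (fun i j l hij hjl hil e₁ e₂ =>
    not_three_equal hs h (fun x y z a b d e f => hm x y z a b d e f) (hv i) (hv j) (hv l)
      (hf.ne hij) (hf.ne hjl) (hf.ne hil) e₁ e₂) with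
    ⟨i, j, l, m, n1, n2, n3, n4, n5, n6⟩ | ⟨i, i', j, j', l, hi, hj, ei, ej, n1, n2, n3⟩
  · -- If every pair from four elements lies in one of two sets, one set contains all four.
    have four : ∀ {T : Multiset C}, T.card = 3 → c v (f i) ∈ T → c v (f j) ∈ T → c v (f l) ∈ T →
        c v (f m) ∈ T → False := by
      intro T hT h1 h2 h3 h4
      have hn : ({c v (f i), c v (f j), c v (f l), c v (f m)} : Multiset C).Nodup := by
        simp [n1, n2, n3, n4, n5, n6]
      have := Multiset.card_le_card ((Multiset.le_iff_subset hn (t := T)).2 (by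
        intro x hx
        simp only [Multiset.insert_eq_cons, Multiset.mem_cons, Multiset.mem_singleton] at hx
        rcases hx with rfl | rfl | rfl | rfl <;> assumption))
      rw [hT] at this
      simp at this
    have s1 := sub i j n1
    have s2 := sub i l n2
    have s3 := sub i m n3
    have s4 := sub j l n4
    have s5 := sub j m n5
    have s6 := sub l m n6
    have t1 := four hT₁
    have t2 := four hT₂
    by_cases hi : c v (f i) ∈ T₁
    · by_cases hj : c v (f j) ∈ T₁
      · by_cases hl : c v (f l) ∈ T₁
        · by_cases hm : c v (f m) ∈ T₁
          · exact t1 hi hj hl hm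
          · have r3 := s3.resolve_left fun e => hm e.2
            have r5 := s5.resolve_left fun e => hm e.2
            have r6 := s6.resolve_left fun e => hm e.2
            exact t2 r3.1 r5.1 r6.1 r6.2
        · have r2 := s2.resolve_left fun e => hl e.2
          have r4 := s4.resolve_left fun e => hl e.2
          have r6 := s6.resolve_left fun e => hl e.1
          exact t2 r2.1 r4.1 r6.1 r6.2
      · have r1 := s1.resolve_left fun e => hj e.2
        have r4 := s4.resolve_left fun e => hj e.1
        have r5 := s5.resolve_left fun e => hj e.1
        exact t2 r1.1 r4.1 r4.2 r5.2
    · have r1 := s1.resolve_left fun e => hi e.1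
      have r2 := s2.resolve_left fun e => hi e.1
      have r3 := s3.resolve_left fun e => hi e.1
      exact t2 r1.1 r1.2 r2.2 r3.2
  · have s1 := sub i j n1
    have s2 := sub j l n2
    have s3 := sub i l n3
    have c1 := cover i i' hi
    have c2 := cover j j' hj
    rw [← ei] at c1
    rw [← ej] at c2
    have t1 := not_double_of_mem hT₁ n1 n2 n3
    have t2 := not_double_of_mem hT₂ n1 n2 n3
    have d1 := not_two_doubles hT₁ n1
    have d2 := not_two_doubles hT₂ n1
    have : (c v (f i) ∈ T₁ ∧ c v (f j) ∈ T₁ ∧ c v (f l) ∈ T₁) ∨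
        (c v (f i) ∈ T₂ ∧ c v (f j) ∈ T₂ ∧ c v (f l) ∈ T₂) := by
      rcases s1 with s1 | s1 <;> rcases s2 with s2 | s2
      · exact Or.inl ⟨s1.1, s1.2, s2.2⟩
      · exact s3.imp (fun s3 => ⟨s1.1, s1.2, s3.2⟩) (fun s3 => ⟨s3.1, s2⟩)
      · exact s3.imp (fun s3 => ⟨s3.1, s2⟩) (fun s3 => ⟨s1.1, s1.2, s3.2⟩)
      · exact Or.inr ⟨s1.1, s1.2, s2.2⟩
    rcases this with ⟨h1, h2, h3⟩ | ⟨h1, h2, h3⟩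
    · exact d2 (c1.resolve_left (t1 h1 h2 h3 _)) (c2.resolve_left (t1 h1 h2 h3 _))
    · exact d1 (c1.resolve_right (t2 h1 h2 h3 _)) (c2.resolve_right (t2 h1 h2 h3 _))

theorem classification_of_mono (hs : ∀ x y, c x y = c y x) {a : C} {T : Multiset C}
    (hT : T.card = 3) (h : ∀ x y z, x ≠ y → y ≠ z → x ≠ z →
      ({c x y, c y z, c x z} : Multiset C) = {a, a, a} ∨
        ({c x y, c y z, c x z} : Multiset C) = T)
    {u v w : V} (huv : u ≠ v) (hvw : v ≠ w) (huw : u ≠ w) (e₁ : c u v = a) (e₂ : c v w = a)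
    (e₃ : c u w = a) :
    (∃ b, ∀ x y z, x ≠ y → y ≠ z → x ≠ z →
        ({c x y, c y z, c x z} : Multiset C) = {a, a, a} ∨
          ({c x y, c y z, c x z} : Multiset C) = {a, a, b}) ∨
      ∃ b, a ≠ b ∧ ∀ x y z, x ≠ y → y ≠ z → x ≠ z →
        ({c x y, c y z, c x z} : Multiset C) = {a, a, a} ∨
          ({c x y, c y z, c x z} : Multiset C) = {a, b, b} := by
  classical
  obtain ⟨x, y, z, rfl⟩ := Multiset.card_eq_three.1 hT
  by_cases hd : (x = a ∧ y = a) ∨ (y = a ∧ z = a) ∨ (x = a ∧ z = a)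
  · left
    rcases hd with ⟨rfl, rfl⟩ | ⟨rfl, rfl⟩ | ⟨rfl, rfl⟩
    · exact ⟨z, h⟩
    · refine ⟨x, ?_⟩
      have : ({x, z, z} : Multiset C) = {z, z, x} := by
        simp only [Multiset.insert_eq_cons, ← Multiset.singleton_add]; abel
      rwa [← this]
    · refine ⟨y, ?_⟩
      have : ({z, y, z} : Multiset C) = {z, z, y} := by
        simp only [Multiset.insert_eq_cons, ← Multiset.singleton_add]; abel
      rwa [← this]
  by_cases hb : (x = a ∧ y = z) ∨ (y = a ∧ x = z) ∨ (z = a ∧ x = y)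
  · right
    rcases hb with ⟨rfl, rfl⟩ | ⟨rfl, rfl⟩ | ⟨rfl, rfl⟩
    · exact ⟨y, by grind, h⟩
    · refine ⟨x, by grind, ?_⟩
      have : ({x, y, x} : Multiset C) = {y, x, x} := by
        simp only [Multiset.insert_eq_cons, ← Multiset.singleton_add]; abel
      rwa [← this]
    · refine ⟨x, by grind, ?_⟩
      have : ({x, x, z} : Multiset C) = {z, x, x} := by
        simp only [Multiset.insert_eq_cons, ← Multiset.singleton_add]; abel
      rwa [← this]
  -- In the remaining case a vertex joined to the `a`-coloured triangle by another colour would see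
  -- its three vertices in three different colours, so every edge has colour `a`.
  left
  have h' : ∀ p q r, p ≠ q → q ≠ r → p ≠ r → c p q = a → (c q r = a ↔ c p r = a) ∧
      (c q r ≠ a → c q r ≠ c p r ∧ (c q r = x ∨ c q r = y ∨ c q r = z)) := by
    intro p q r hpq hqr hpr e
    rcases h p q r hpq hqr hpr with h | h <;> have := triple_eq h <;> clear h <;> grind
  have hu : ∀ p, u ≠ p → c u p = a := by
    intro p hup
    by_cases hpv : p = v
    · rwa [hpv]
    by_cases hpw : p = w
    · rwa [hpw]
    have h1 := h' u v p huv (Ne.symm hpv) hup e₁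
    have h3 := h' u w p huw (Ne.symm hpw) hup e₃
    have k2 := h u v p huv (Ne.symm hpv) hup
    have k3 := h u w p huw (Ne.symm hpw) hup
    by_contra hne
    have j1 : ({c u v, c v p, c u p} : Multiset C) = {x, y, z} :=
      k2.resolve_left fun e => by have := triple_eq e; grind
    have j2 : ({c u w, c w p, c u p} : Multiset C) = {x, y, z} :=
      k3.resolve_left fun e => by have := triple_eq e; grind
    have j := triple_eq (j1.trans j2.symm)
    grind
  refine ⟨a, fun p q r hpq hqr hpr => Or.inl ?_⟩
  have all : ∀ p q, p ≠ q → c p q = a := by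
    intro p q hpq
    by_cases hp : u = p
    · subst hp; exact hu q hpq
    by_cases hq : u = q
    · subst hq; rw [hs]; exact hu p hpq.symm
    exact (h' u p q hp hpq hq (hu p hp)).1.2 (hu q hq)
  rw [all p q hpq, all q r hqr, all p r hpr]

/-- The possible colourings of the edges of a complete graph on at least six vertices such that
at most two multisets of colours occur on triangles. In the first case the edges of a colour other
than `a` form a matching; in the second one the edges of colour `a` form at most two cliques, joined
by edges of colour `b`. -/
theorem colouring_classification [Fintype V] (hV : 6 ≤ Fintype.card V)
    (hs : ∀ x y, c x y = c y x) {T₁ T₂ : Multiset C} (hT₁ : T₁.card = 3) (hT₂ : T₂.card = 3)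
    (h : ∀ x y z, x ≠ y → y ≠ z → x ≠ z →
      ({c x y, c y z, c x z} : Multiset C) = T₁ ∨ ({c x y, c y z, c x z} : Multiset C) = T₂) :
    ∃ a, (∃ b, ∀ x y z, x ≠ y → y ≠ z → x ≠ z →
        ({c x y, c y z, c x z} : Multiset C) = {a, a, a} ∨
          ({c x y, c y z, c x z} : Multiset C) = {a, a, b}) ∨
      ∃ b, a ≠ b ∧ ∀ x y z, x ≠ y → y ≠ z → x ≠ z →
        ({c x y, c y z, c x z} : Multiset C) = {a, a, a} ∨
          ({c x y, c y z, c x z} : Multiset C) = {a, b, b} := by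
  obtain ⟨u, v, w, huv, hvw, huw, e₁, e₂⟩ := exists_mono_triangle hV hs hT₁ hT₂ h
  refine ⟨c u w, ?_⟩
  rcases h u v w huv hvw huw with h1 | h1 <;> rw [e₁, e₂] at h1 <;> subst h1
  · exact classification_of_mono hs hT₂ h huv hvw huw (e₁.trans e₂) e₂ rfl
  · exact classification_of_mono hs hT₁ (fun x y z hxy hyz hxz => (h x y z hxy hyz hxz).symm)
      huv hvw huw (e₁.trans e₂) e₂ rfl

end Colouring

/-! ### Dimension bounds from quadratic forms -/

section InnerProduct
variable {E : Type*} [NormedAddCommGroup E] [InnerProductSpace ℝ E] {P : Finset E}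

theorem sum_mul_norm_sub_sq (P : Finset E) (c : E → ℝ) (hc : ∑ x ∈ P, c x = 0) :
    ∑ x ∈ P, ∑ y ∈ P, c x * c y * ‖x - y‖ ^ 2 = -2 * ‖∑ x ∈ P, c x • x‖ ^ 2 := by
  have h1 : ∀ x y : E, c x * c y * ‖x - y‖ ^ 2 =
      c x * ‖x‖ ^ 2 * c y + c x * (c y * ‖y‖ ^ 2) - 2 * (c x * (c y * ⟪x, y⟫)) := by
    intro x y
    rw [norm_sub_sq_real]; ring
  have h2 : ‖∑ x ∈ P, c x • x‖ ^ 2 = ∑ x ∈ P, c x * ∑ y ∈ P, c y * ⟪x, y⟫ := by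
    rw [← real_inner_self_eq_norm_sq, sum_inner]
    refine Finset.sum_congr rfl fun x _ => ?_
    rw [real_inner_smul_left, inner_sum]
    simp only [real_inner_smul_right]
  simp only [h1, h2, Finset.sum_add_distrib, Finset.sum_sub_distrib, ← Finset.mul_sum,
    ← Finset.sum_mul, hc]
  ring

/-- The vectors `(x, g x)` are linearly independent, hence at most `dim E + dim F` in number. -/
theorem card_le_finrank_add [FiniteDimensional ℝ E] {F : Type*} [AddCommGroup F] [Module ℝ F]
    [FiniteDimensional ℝ F] (P : Finset E) (g : E → F)
    (h : ∀ c : E → ℝ, ∑ x ∈ P, c x • x = 0 → ∑ x ∈ P, c x • g x = 0 → ∀ x ∈ P, c x = 0) :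
    P.card ≤ finrank ℝ E + finrank ℝ F := by
  have hl : LinearIndepOn ℝ (fun x : E => (x, g x)) (P : Set E) := by
    rw [linearIndepOn_finset_iff]
    intro c hc
    have h1 := congrArg Prod.fst hc
    have h2 := congrArg Prod.snd hc
    simp only [Prod.fst_sum, Prod.snd_sum, Prod.smul_fst, Prod.smul_snd, Prod.fst_zero,
      Prod.snd_zero] at h1 h2
    exact h c h1 h2
  have := LinearIndependent.fintype_card_le_finrank hl
  simpa using this

/-- A set with two distances `√A`, `√B`, where `B < 2 * A` and the pairs at distance `√B` form a
matching, is affinely independent: the quadratic form given by its squared distances is negative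
definite on the vectors of coordinate sum zero. -/
theorem card_le_of_matching [FiniteDimensional ℝ E] {A B : ℝ} (hB : 0 < B) (hBA : B < 2 * A)
    (h : ∀ x ∈ P, ∀ y ∈ P, x ≠ y → ‖x - y‖ ^ 2 = A ∨ ‖x - y‖ ^ 2 = B)
    (hm : ∀ x ∈ P, ∀ y ∈ P, ∀ z ∈ P, x ≠ y → y ≠ z → x ≠ z → ‖x - y‖ ^ 2 = A ∨ ‖x - z‖ ^ 2 = A) :
    P.card ≤ finrank ℝ E + 1 := by
  classical
  rw [← finrank_self ℝ]
  refine card_le_finrank_add P (fun _ => (1 : ℝ)) fun c hc hc1 => ?_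
  simp only [smul_eq_mul, mul_one] at hc1
  -- `ε` is the adjacency matrix of the matching; as its row sums are at most one, its quadratic form
  -- is bounded by the sum of squares.
  set ε : E → E → ℝ := fun x y => if x ≠ y ∧ ‖x - y‖ ^ 2 ≠ A then 1 else 0 with hε
  have ε0 : ∀ x y, 0 ≤ ε x y := fun x y => by simp only [hε]; split_ifs <;> norm_num
  have εs : ∀ x y, ε x y = ε y x := fun x y => by simp only [hε, ne_comm, norm_sub_rev]
  have hdeg : ∀ x ∈ P, ∑ y ∈ P, ε x y ≤ 1 := by
    intro x hx
    simp only [hε, Finset.sum_boole]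
    norm_cast
    rw [Finset.card_le_one]
    intro y hy z hz
    simp only [Finset.mem_filter] at hy hz
    by_contra hyz
    rcases hm x hx y hy.1 z hz.1 hy.2.1 hyz hz.2.1 with h | h
    · exact hy.2.2 h
    · exact hz.2.2 h
  have hD : ∀ x ∈ P, ∀ y ∈ P, c x * c y * ‖x - y‖ ^ 2 =
      A * (c x * c y) - (if x = y then A * (c x * c y) else 0) + (B - A) * (c x * c y * ε x y) := by
    intro x hx y hy
    by_cases hxy : x = y
    · simp [hε, hxy]
    · by_cases hA : ‖x - y‖ ^ 2 = A
      · simp [hε, hxy, hA]; ring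
      · simp [hε, hxy, (h x hx y hy hxy).resolve_left hA,
          ((h x hx y hy hxy).resolve_left hA).symm.trans_ne hA]; ring
  have hsum := sum_mul_norm_sub_sq P c hc1
  rw [Finset.sum_congr rfl fun x hx => Finset.sum_congr rfl fun y hy => hD x hx y hy, hc] at hsum
  simp only [Finset.sum_add_distrib, Finset.sum_sub_distrib, ← Finset.mul_sum, hc1,
    Finset.sum_ite_eq] at hsum
  set S := ∑ x ∈ P, ∑ y ∈ P, c x * c y * ε x y with hS
  set Q := ∑ x ∈ P, c x ^ 2 with hQ
  have hq : ∑ x ∈ P, (if x ∈ P then A * (c x * c x) else 0) = A * Q := by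
    rw [hQ, Finset.mul_sum]
    refine Finset.sum_congr rfl fun x hx => ?_
    rw [if_pos hx, sq]
  rw [hq] at hsum
  have hdQ : ∑ x ∈ P, ∑ y ∈ P, c x ^ 2 * ε x y ≤ Q := by
    refine Finset.sum_le_sum fun x hx => ?_
    rw [← Finset.mul_sum]
    exact mul_le_of_le_one_right (sq_nonneg _) (hdeg x hx)
  have hdQ' : ∑ x ∈ P, ∑ y ∈ P, c y ^ 2 * ε x y ≤ Q := by
    rw [Finset.sum_comm]
    simpa only [εs] using hdQ
  have hbound : ∀ s : ℝ, s ^ 2 = 1 → s * S ≤ Q := by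
    intro s hs
    have : s * S ≤ (∑ x ∈ P, ∑ y ∈ P, c x ^ 2 * ε x y + ∑ x ∈ P, ∑ y ∈ P, c y ^ 2 * ε x y) / 2 := by
      rw [hS, ← Finset.sum_add_distrib, Finset.mul_sum, Finset.sum_div]
      refine Finset.sum_le_sum fun x _ => ?_
      rw [← Finset.sum_add_distrib, Finset.mul_sum, Finset.sum_div]
      refine Finset.sum_le_sum fun y _ => ?_
      have : 0 ≤ (c x - s * c y) ^ 2 * ε x y := mul_nonneg (sq_nonneg _) (ε0 x y)
      have e : (c x - s * c y) ^ 2 = c x ^ 2 - 2 * s * (c x * c y) + c y ^ 2 := by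
        rw [sub_sq, mul_pow, hs]; ring
      rw [e] at this
      linarith
    linarith
  have b1 := hbound 1 (by norm_num)
  have b2 := hbound (-1) (by norm_num)
  have Q0 : 0 ≤ Q := Finset.sum_nonneg fun x _ => sq_nonneg _
  have hQ0 : Q = 0 := by
    simp only [mul_zero, Finset.sum_const_zero, norm_zero] at hsum
    have hAQ : A * Q = (B - A) * S := by
      norm_num at hsum
      linarith
    rcases le_total 0 (B - A) with h0 | h0
    · nlinarith
    · nlinarith
  intro x hx
  have := (Finset.sum_eq_zero_iff_of_nonneg fun x _ => sq_nonneg (c x)).1 hQ0 x hx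
  simpa using this

/-- Two regular simplices of side `√A`, all of whose cross distances are `√B`, have at most `d + 2`
vertices: the quadratic form of the squared distances is negative definite on the coefficients whose
sum over each of the two simplices vanishes. -/
theorem card_le_of_two_cliques [FiniteDimensional ℝ E] {A B : ℝ} (hA : 0 < A) (κ : E → Prop)
    (h : ∀ x ∈ P, ∀ y ∈ P, x ≠ y → (κ x ↔ κ y) → ‖x - y‖ ^ 2 = A)
    (h' : ∀ x ∈ P, ∀ y ∈ P, ¬ (κ x ↔ κ y) → ‖x - y‖ ^ 2 = B) :
    P.card ≤ finrank ℝ E + 2 := by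
  classical
  have : finrank ℝ (ℝ × ℝ) = 2 := by simp
  rw [← this]
  set f : E → ℝ := fun x => if κ x then 1 else 0 with hf
  set g : E → ℝ := fun x => if κ x then 0 else 1 with hg
  refine card_le_finrank_add P (fun x => (f x, g x)) fun c hc hc1 => ?_
  have hcf := congrArg Prod.fst hc1
  have hcg := congrArg Prod.snd hc1
  simp only [Prod.fst_sum, Prod.snd_sum, Prod.smul_mk, Prod.fst_zero, Prod.snd_zero,
    smul_eq_mul] at hcf hcg
  have hc0 : ∑ x ∈ P, c x = 0 := by
    rw [← add_zero (0 : ℝ)]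
    nth_rewrite 1 [← hcf]
    rw [← hcg, ← Finset.sum_add_distrib]
    refine Finset.sum_congr rfl fun x _ => ?_
    by_cases hx : κ x <;> simp [hf, hg, hx]
  have hD : ∀ x ∈ P, ∀ y ∈ P, c x * c y * ‖x - y‖ ^ 2 =
      A * (c x * f x) * (c y * f y) + A * (c x * g x) * (c y * g y) +
        B * (c x * f x) * (c y * g y) + B * (c x * g x) * (c y * f y) -
        (if x = y then A * (c x * c y) else 0) := by
    intro x hx y hy
    by_cases hxy : x = y
    · subst hxy
      by_cases hx : κ x <;> simp [hf, hg, hx] <;> ring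
    · by_cases k1 : κ x <;> by_cases k2 : κ y
      · rw [h x hx y hy hxy (by tauto)]; simp [hf, hg, k1, k2, hxy]; ring
      · rw [h' x hx y hy (by tauto)]; simp [hf, hg, k1, k2, hxy]; ring
      · rw [h' x hx y hy (by tauto)]; simp [hf, hg, k1, k2, hxy]; ring
      · rw [h x hx y hy hxy (by tauto)]; simp [hf, hg, k1, k2, hxy]; ring
  have hsum := sum_mul_norm_sub_sq P c hc0
  rw [Finset.sum_congr rfl fun x hx => Finset.sum_congr rfl fun y hy => hD x hx y hy, hc] at hsum
  simp only [Finset.sum_add_distrib, Finset.sum_sub_distrib, ← Finset.mul_sum, hcf, hcg,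
    Finset.sum_ite_eq, mul_zero, Finset.sum_const_zero, norm_zero] at hsum
  have hQ : ∑ x ∈ P, A * c x ^ 2 = 0 := by
    have : ∑ x ∈ P, A * c x ^ 2 = ∑ x ∈ P, (if x ∈ P then A * (c x * c x) else 0) :=
      Finset.sum_congr rfl fun x hx => by rw [if_pos hx, sq]
    rw [this]
    norm_num at hsum
    simpa using hsum
  intro x hx
  have := (Finset.sum_eq_zero_iff_of_nonneg fun x _ => mul_nonneg hA.le (sq_nonneg (c x))).1 hQ x hx
  simpa [hA.ne'] using this

/-- A configuration of vectors of equal length around a centre `o`, any two of them orthogonal or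
opposite. -/
def IsCross (P : Finset E) (o : E) (ρ : ℝ) : Prop :=
  (∀ x ∈ P, ‖x - o‖ ^ 2 = ρ) ∧
    ∀ x ∈ P, ∀ y ∈ P, x ≠ y → ⟪x - o, y - o⟫ = 0 ∨ x - o = -(y - o)

/-- The centre of the cross is the midpoint of any pair at the larger distance. -/
theorem isCross_of_matching {A : ℝ}
    (h : ∀ x ∈ P, ∀ y ∈ P, x ≠ y → ‖x - y‖ ^ 2 = A ∨ ‖x - y‖ ^ 2 = 2 * A)
    (hm : ∀ x ∈ P, ∀ y ∈ P, ∀ z ∈ P, x ≠ y → y ≠ z → x ≠ z → ‖x - y‖ ^ 2 = A ∨ ‖x - z‖ ^ 2 = A)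
    {p q : E} (hp : p ∈ P) (hq : q ∈ P) (hpq : ‖p - q‖ ^ 2 = 2 * A) (hA : 0 < A) :
    IsCross P ((1 / 2 : ℝ) • (p + q)) (A / 2) := by
  have hne : p ≠ q := by rintro rfl; simp at hpq; linarith
  have hA2 : 2 * A ≠ A := by linarith
  set o := (1 / 2 : ℝ) • (p + q) with ho
  have ha : ‖p - o‖ ^ 2 = A / 2 := by
    have : p - o = (1 / 2 : ℝ) • (p - q) := by rw [ho]; module
    rw [this, norm_smul, mul_pow, hpq]; norm_num; ring
  have hqo : q - o = -(p - o) := by rw [ho]; module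
  have hr : ∀ x ∈ P, ‖x - o‖ ^ 2 = A / 2 := by
    intro x hx
    by_cases hxp : x = p
    · rwa [hxp]
    by_cases hxq : x = q
    · rw [hxq, hqo, norm_neg, ha]
    have h1 : ‖p - x‖ ^ 2 = A :=
      (hm p hp q hq x hx hne (Ne.symm hxq) (Ne.symm hxp)).resolve_left (by rwa [hpq])
    have h2 : ‖q - x‖ ^ 2 = A :=
      (hm q hq p hp x hx hne.symm (Ne.symm hxp) (Ne.symm hxq)).resolve_left
        (by rwa [norm_sub_rev, hpq])
    have e1 : p - x = (p - o) - (x - o) := by abel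
    have e2 : q - x = -((p - o) + (x - o)) := by rw [neg_add, ← hqo]; abel
    rw [e1, norm_sub_sq_real] at h1
    rw [e2, norm_neg, norm_add_sq_real] at h2
    linarith
  refine ⟨hr, fun x hx y hy hxy => ?_⟩
  have hx' := hr x hx
  have hy' := hr y hy
  have e : x - y = (x - o) - (y - o) := by abel
  have := h x hx y hy hxy
  rw [e, norm_sub_sq_real, hx', hy'] at this
  rcases this with h | h
  · left; linarith
  · right
    rw [eq_neg_iff_add_eq_zero, ← norm_eq_zero, ← sq_eq_zero_iff, norm_add_sq_real, hx', hy']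
    linarith

theorem isCross_of_matching_of_card [FiniteDimensional ℝ E] {A B : ℝ} (hA : 0 < A) (hB : 0 < B)
    (h : ∀ x ∈ P, ∀ y ∈ P, x ≠ y → ‖x - y‖ ^ 2 = A ∨ ‖x - y‖ ^ 2 = B)
    (hm : ∀ x ∈ P, ∀ y ∈ P, ∀ z ∈ P, x ≠ y → y ≠ z → x ≠ z → ‖x - y‖ ^ 2 = A ∨ ‖x - z‖ ^ 2 = A)
    (hP : finrank ℝ E + 3 ≤ P.card) : ∃ o : E, ∃ ρ > 0, IsCross P o ρ := by
  classical
  -- A regular simplex is too small, even after removing a point.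
  have pair : ∀ Q ⊆ P, finrank ℝ E + 2 ≤ Q.card →
      ∃ p ∈ Q, ∃ q ∈ Q, p ≠ q ∧ ‖p - q‖ ^ 2 ≠ A := by
    intro Q hQ hc
    by_contra! hall
    have := card_le_of_matching (P := Q) hA (by linarith : A < 2 * A)
      (fun x hx y hy hxy => Or.inl (hall x hx y hy hxy))
      (fun x hx y hy z _ hxy _ _ => Or.inl (hall x hx y hy hxy))
    omega
  obtain ⟨p, hp, q, hq, hpq, hpqA⟩ := pair P subset_rfl (by omega)
  have hpqB := (h p hp q hq hpq).resolve_left hpqA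
  rcases lt_trichotomy B (2 * A) with hBA | rfl | hBA
  · have := card_le_of_matching hB hBA h hm
    omega
  · exact ⟨_, A / 2, by linarith, isCross_of_matching h hm hp hq hpqB hA⟩
  · exfalso
    obtain ⟨s, hs, t, ht, hst, hstA⟩ := pair (P.erase p) (Finset.erase_subset _ _) (by
      rw [Finset.card_erase_of_mem hp]; omega)
    have hsp := Finset.ne_of_mem_erase hs
    have htp := Finset.ne_of_mem_erase ht
    replace hs := Finset.mem_of_mem_erase hs
    replace ht := Finset.mem_of_mem_erase ht
    have hqpA : ‖q - p‖ ^ 2 ≠ A := by rwa [norm_sub_rev]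
    have htsA : ‖t - s‖ ^ 2 ≠ A := by rwa [norm_sub_rev]
    have hsq : s ≠ q := by
      rintro rfl
      exact (hm s hs p hp t ht hsp htp.symm hst).elim hqpA hstA
    have htq : t ≠ q := by
      rintro rfl
      exact (hm t ht p hp s hs htp hsp.symm hst.symm).elim hqpA htsA
    have hstB := (h s hs t ht hst).resolve_left hstA
    have h1 : ‖p - s‖ ^ 2 = A := (hm p hp q hq s hs hpq hsq.symm hsp.symm).resolve_left hpqA
    have h2 : ‖p - t‖ ^ 2 = A := (hm p hp q hq t ht hpq htq.symm htp.symm).resolve_left hpqA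
    have h3 : ‖q - s‖ ^ 2 = A := (hm q hq p hp s hs hpq.symm hsp.symm hsq.symm).resolve_left hqpA
    have h4 : ‖q - t‖ ^ 2 = A := (hm q hq p hp t ht hpq.symm htp.symm htq.symm).resolve_left hqpA
    -- Two disjoint pairs at a distance this large contradict positivity of the norm.
    have key : ‖p + q - s - t‖ ^ 2 = 4 * A - 2 * B := by
      have e : ‖p + q - s - t‖ ^ 2 = ‖p - s‖ ^ 2 + ‖p - t‖ ^ 2 + ‖q - s‖ ^ 2 + ‖q - t‖ ^ 2 -
          ‖p - q‖ ^ 2 - ‖s - t‖ ^ 2 := by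
        simp only [← real_inner_self_eq_norm_sq, inner_sub_left, inner_sub_right, inner_add_left,
          inner_add_right, real_inner_comm q p, real_inner_comm s p, real_inner_comm t p,
          real_inner_comm s q, real_inner_comm t q, real_inner_comm t s]
        ring
      rw [e, h1, h2, h3, h4, hpqB, hstB]; ring
    have := sq_nonneg ‖p + q - s - t‖
    linarith

end InnerProduct

/-! ### Cross configurations and orthoplexes -/

section InnerProduct
variable {E : Type*} [NormedAddCommGroup E] [InnerProductSpace ℝ E] {P : Finset E}

/-- A large set with two types of triangles is a cross configuration. -/
theorem HasSides.exists_isCross [FiniteDimensional ℝ E] {T₁ T₂ : Multiset ℝ}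
    (h : HasSides P T₁ T₂) (hT₁ : T₁.card = 3) (hT₂ : T₂.card = 3)
    (hnd : ∃ x ∈ P, ∃ y ∈ P, ∃ z ∈ P, gram (y - x) (z - x) ≠ 0) (hP : 6 ≤ P.card)
    (hPd : finrank ℝ E + 3 ≤ P.card) : ∃ o : E, ∃ ρ > 0, IsCross P o ρ := by
  classical
  have hpos : ∀ x y : E, x ≠ y → 0 < ‖x - y‖ ^ 2 := fun x y hxy => by
    have := norm_pos_iff.2 (sub_ne_zero.2 hxy)
    positivity
  have third : ∀ x y : E, ∃ z ∈ P, z ≠ x ∧ z ≠ y := by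
    intro x y
    obtain ⟨z, hz⟩ : (P \ {x, y}).Nonempty := by
      rw [← Finset.card_pos]
      have h1 := Finset.le_card_sdiff {x, y} P
      have h2 := Finset.card_le_two (a := x) (b := y)
      omega
    simp only [Finset.mem_sdiff, Finset.mem_insert, Finset.mem_singleton, not_or] at hz
    exact ⟨z, hz⟩
  obtain ⟨A, hAB⟩ := colouring_classification (V := P)
    (c := fun x y => ‖(x : E) - y‖ ^ 2) (by simpa using hP)
    (fun x y => by rw [norm_sub_rev]) hT₁ hT₂ (fun x y z hxy hyz hxz =>
      h x x.2 y y.2 z z.2 (h.gram_ne_zero hP hnd x.2 y.2 z.2 (Subtype.coe_ne_coe.2 hxy)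
        (Subtype.coe_ne_coe.2 hyz) (Subtype.coe_ne_coe.2 hxz)))
  rcases hAB with ⟨B, hAB⟩ | ⟨B, hne, hAB⟩
  · have hAB' : ∀ x ∈ P, ∀ y ∈ P, ∀ z ∈ P, x ≠ y → y ≠ z → x ≠ z →
        (‖x - y‖ ^ 2 = A ∧ ‖y - z‖ ^ 2 = A ∧ ‖x - z‖ ^ 2 = A) ∨
        (‖x - y‖ ^ 2 = A ∧ ‖y - z‖ ^ 2 = A ∧ ‖x - z‖ ^ 2 = B) ∨
        (‖x - y‖ ^ 2 = A ∧ ‖y - z‖ ^ 2 = B ∧ ‖x - z‖ ^ 2 = A) ∨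
        (‖x - y‖ ^ 2 = B ∧ ‖y - z‖ ^ 2 = A ∧ ‖x - z‖ ^ 2 = A) := by
      intro x hx y hy z hz hxy hyz hxz
      rcases hAB ⟨x, hx⟩ ⟨y, hy⟩ ⟨z, hz⟩ (by simpa using hxy) (by simpa using hyz)
        (by simpa using hxz) with h | h <;> have := triple_eq h <;> tauto
    have hm : ∀ x ∈ P, ∀ y ∈ P, ∀ z ∈ P, x ≠ y → y ≠ z → x ≠ z →
        ‖x - y‖ ^ 2 = A ∨ ‖x - z‖ ^ 2 = A := by
      intro x hx y hy z hz hxy hyz hxz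
      have := hAB' x hx y hy z hz hxy hyz hxz
      tauto
    have h2 : ∀ x ∈ P, ∀ y ∈ P, x ≠ y → ‖x - y‖ ^ 2 = A ∨ ‖x - y‖ ^ 2 = B := by
      intro x hx y hy hxy
      obtain ⟨z, hz, hzx, hzy⟩ := third x y
      have := hAB' x hx y hy z hz hxy hzy.symm hzx.symm
      tauto
    obtain ⟨x, hx⟩ : P.Nonempty := Finset.card_pos.1 (by omega)
    obtain ⟨y, hy, hyx, -⟩ := third x x
    obtain ⟨z, hz, hzx, hzy⟩ := third x y
    have hA : 0 < A := by
      rcases hm x hx y hy z hz hyx.symm hzy.symm hzx.symm with rfl | rfl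
      · exact hpos _ _ hyx.symm
      · exact hpos _ _ hzx.symm
    -- If the second distance does not occur, it may be replaced by the first.
    by_cases hB : 0 < B
    · exact isCross_of_matching_of_card hA hB h2 hm hPd
    · refine isCross_of_matching_of_card hA hA (fun x hx y hy hxy => Or.inl ?_) hm hPd
      exact (h2 x hx y hy hxy).resolve_right fun e => hB (e ▸ hpos x y hxy)
  · exfalso
    have hAB' : ∀ x ∈ P, ∀ y ∈ P, ∀ z ∈ P, x ≠ y → y ≠ z → x ≠ z →
        (‖x - y‖ ^ 2 = A ∧ ‖y - z‖ ^ 2 = A ∧ ‖x - z‖ ^ 2 = A) ∨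
        (‖x - y‖ ^ 2 = A ∧ ‖y - z‖ ^ 2 = B ∧ ‖x - z‖ ^ 2 = B) ∨
        (‖x - y‖ ^ 2 = B ∧ ‖y - z‖ ^ 2 = A ∧ ‖x - z‖ ^ 2 = B) ∨
        (‖x - y‖ ^ 2 = B ∧ ‖y - z‖ ^ 2 = B ∧ ‖x - z‖ ^ 2 = A) := by
      intro x hx y hy z hz hxy hyz hxz
      rcases hAB ⟨x, hx⟩ ⟨y, hy⟩ ⟨z, hz⟩ (by simpa using hxy) (by simpa using hyz)
        (by simpa using hxz) with h | h <;> have := triple_eq h <;> tauto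
    obtain ⟨p, hp⟩ : P.Nonempty := Finset.card_pos.1 (by omega)
    obtain ⟨y, hy, hyp, -⟩ := third p p
    obtain ⟨z, hz, hzp, hzy⟩ := third p y
    have hA : 0 < A := by
      rcases hAB' p hp y hy z hz hyp.symm hzy.symm hzp.symm with h | h | h | h
      · exact h.1 ▸ hpos _ _ hyp.symm
      · exact h.1 ▸ hpos _ _ hyp.symm
      · exact h.2.1 ▸ hpos _ _ hzy.symm
      · exact h.2.2 ▸ hpos _ _ hzp.symm
    have h1 : ∀ y ∈ P, p ≠ y → ‖p - y‖ ^ 2 = A ∨ ‖p - y‖ ^ 2 = B := by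
      intro y hy hpy
      obtain ⟨z, hz, hzp, hzy⟩ := third p y
      have := hAB' p hp y hy z hz hpy hzy.symm hzp.symm
      tauto
    have := card_le_of_two_cliques (P := P) hA (B := B) (fun x => x = p ∨ ‖p - x‖ ^ 2 = A)
      (by
        intro x hx y hy hxy hk
        by_cases hxp : x = p
        · subst hxp; simpa [hxy.symm] using hk
        by_cases hyp : y = p
        · subst hyp; rw [norm_sub_rev]; simpa [hxy] using hk
        have h3 := hAB' p hp x hx y hy (Ne.symm hxp) hxy (Ne.symm hyp)
        simp only [hxp, hyp, false_or] at hk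
        rcases h3 with ⟨e₁, e₂, e₃⟩ | ⟨e₁, e₂, e₃⟩ | ⟨e₁, e₂, e₃⟩ | ⟨e₁, e₂, e₃⟩
        · exact e₂
        · exact absurd ((e₃.symm.trans (hk.1 e₁)).symm) hne
        · exact e₂
        · exact absurd ((e₁.symm.trans (hk.2 e₃)).symm) hne)
      (by
        intro x hx y hy hk
        by_cases hxp : x = p
        · subst hxp
          by_cases hxy : x = y
          · simp [hxy] at hk
          · exact (h1 y hy hxy).resolve_left fun e => hk (by simp [e])
        by_cases hyp : y = p
        · subst hyp
          rw [norm_sub_rev]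
          exact (h1 x hx (Ne.symm hxp)).resolve_left fun e => hk (by simp [e])
        have hxy : x ≠ y := by rintro rfl; simp at hk
        have h3 := hAB' p hp x hx y hy (Ne.symm hxp) hxy (Ne.symm hyp)
        simp only [hxp, hyp, false_or] at hk
        rcases h3 with ⟨e₁, e₂, e₃⟩ | ⟨e₁, e₂, e₃⟩ | ⟨e₁, e₂, e₃⟩ | ⟨e₁, e₂, e₃⟩
        · exact absurd (iff_of_true e₁ e₃) hk
        · exact e₂
        · exact absurd (by rw [e₁, e₃]) hk
        · exact e₂)
    omega

/-- A cross configuration consists of an orthogonal system, chosen of maximal size, and some of the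
opposite vectors. -/
theorem IsCross.exists_orthogonal {o : E} {ρ : ℝ} (h : IsCross P o ρ) :
    ∃ Q ⊆ P, (∀ x ∈ Q, ∀ y ∈ Q, x ≠ y → ⟪x - o, y - o⟫ = 0) ∧
      ∀ x ∈ P, x ∈ Q ∨ ∃ y ∈ Q, x - o = -(y - o) := by
  classical
  obtain ⟨Q, hQ, hmax⟩ := Finset.exists_max_image
    (P.powerset.filter fun Q => ∀ x ∈ Q, ∀ y ∈ Q, x ≠ y → ⟪x - o, y - o⟫ = 0) Finset.card
    ⟨∅, by simp⟩
  simp only [Finset.mem_filter, Finset.mem_powerset] at hQ hmax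
  refine ⟨Q, hQ.1, hQ.2, fun x hx => ?_⟩
  by_contra! hx'
  have := hmax (insert x Q) ⟨Finset.insert_subset hx hQ.1, by
    have hort : ∀ y ∈ Q, ⟪x - o, y - o⟫ = 0 := fun y hy =>
      (h.2 x hx y (hQ.1 hy) (by rintro rfl; exact hx'.1 hy)).resolve_right (hx'.2 y hy)
    intro y hy z hz hyz
    rcases Finset.mem_insert.1 hy with rfl | hy
    · rcases Finset.mem_insert.1 hz with rfl | hz
      · exact absurd rfl hyz
      · exact hort z hz
    · rcases Finset.mem_insert.1 hz with rfl | hz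
      · rw [real_inner_comm]; exact hort y ‹_›
      · exact hQ.2 y hy z hz hyz⟩
  rw [Finset.card_insert_of_notMem hx'.1] at this
  omega

end InnerProduct

section Euclidean
variable {d : ℕ} {P : Finset (EuclideanSpace ℝ (Fin d))}

theorem orthonormal_smul_sub {E : Type*} [NormedAddCommGroup E] [InnerProductSpace ℝ E]
    {P Q : Finset E} {o : E} {ρ : ℝ} (h : IsCross P o ρ) (hρ : 0 < ρ) (hQP : Q ⊆ P)
    (hQ : ∀ x ∈ Q, ∀ y ∈ Q, x ≠ y → ⟪x - o, y - o⟫ = 0) :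
    Orthonormal ℝ fun x : Q => (√ρ)⁻¹ • ((x : E) - o) := by
  have hr : 0 < √ρ := Real.sqrt_pos.2 hρ
  constructor
  · intro x
    have : ‖(x : E) - o‖ = √ρ := by
      rw [← h.1 x (hQP x.2), Real.sqrt_sq (norm_nonneg _)]
    rw [norm_smul, this, norm_inv, Real.norm_of_nonneg hr.le, inv_mul_cancel₀ hr.ne']
  · intro x y hxy
    simp only [real_inner_smul_left, real_inner_smul_right]
    rw [hQ x x.2 y y.2 (Subtype.coe_ne_coe.2 hxy)]
    simp

theorem IsCross.card_le {o : EuclideanSpace ℝ (Fin d)} {ρ : ℝ} (h : IsCross P o ρ) (hρ : 0 < ρ) :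
    P.card ≤ 2 * d ∧ (P.card = 2 * d → IsOrthoplex P) := by
  classical
  obtain ⟨Q, hQP, hQ, hcov⟩ := h.exists_orthogonal
  have hon := orthonormal_smul_sub h hρ hQP hQ
  have hQd : Q.card ≤ d := by
    have := hon.linearIndependent.fintype_card_le_finrank
    simpa using this
  have hsub : P ⊆ Q ∪ Q.image fun y => o - (y - o) := by
    intro x hx
    rw [Finset.mem_union, Finset.mem_image]
    refine (hcov x hx).imp id ?_
    rintro ⟨y, hy, hxy⟩
    exact ⟨y, hy, by rw [sub_eq_add_neg o, ← hxy]; abel⟩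
  have hU : (Q ∪ Q.image fun y => o - (y - o)).card ≤ 2 * Q.card := by
    have h1 := Finset.card_union_le Q (Q.image fun y => o - (y - o))
    have h2 := Finset.card_image_le (s := Q) (f := fun y => o - (y - o))
    omega
  have hPU := Finset.card_le_card hsub
  refine ⟨by omega, fun hcard => ?_⟩
  have hPeq : P = Q ∪ Q.image fun y => o - (y - o) := Finset.eq_of_subset_of_card_le hsub (by omega)
  have hQcard : Q.card = d := by omega
  let e := Q.equivFinOfCardEq hQcard
  have hon' := hon.comp e.symm e.symm.injective
  obtain ⟨b, hb⟩ := Orthonormal.exists_orthonormalBasis_extension_of_card_eq (𝕜 := ℝ)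
    (ι := Fin d) (E := EuclideanSpace ℝ (Fin d)) (by simp) (s := Set.univ)
    (v := (fun x : Q => (√ρ)⁻¹ • ((x : EuclideanSpace ℝ (Fin d)) - o)) ∘ e.symm)
    (hon'.comp (fun i : (Set.univ : Set (Fin d)) => (i : Fin d)) Subtype.val_injective)
  have hr : 0 < √ρ := Real.sqrt_pos.2 hρ
  have hbe : ∀ i, √ρ • b i + o = e.symm i := by
    intro i
    rw [hb i (Set.mem_univ i)]
    simp [smul_smul, hr.ne']
  -- The similarity `e_i ↦ o + √ρ • b i`.
  let f : EuclideanSpace ℝ (Fin d) ≃ᵈ EuclideanSpace ℝ (Fin d) :=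
    (b.repr.symm.toIsometryEquiv.toDilationEquiv.trans
      (DilationEquiv.smulTorsor (0 : EuclideanSpace ℝ (Fin d)) hr.ne')).trans
      (IsometryEquiv.addRight o).toDilationEquiv
  have hf : ∀ x, f x = √ρ • b.repr.symm x + o := by
    intro x
    simp [f]
  have hfs : ∀ (i : Fin d) (t : ℝ), f (EuclideanSpace.single i t) = t • (√ρ • b i) + o := by
    intro i t
    have : EuclideanSpace.single i t = t • EuclideanSpace.single i (1 : ℝ) := by
      ext j; simp
    rw [hf, this, map_smul, OrthonormalBasis.repr_symm_single, smul_comm]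
  refine ⟨f, ?_⟩
  ext x
  rw [hPeq]
  simp only [Finset.coe_union, Finset.coe_image, Set.mem_union, Set.mem_image, Finset.mem_coe]
  constructor
  · rintro (hx | ⟨y, hy, rfl⟩)
    · refine ⟨EuclideanSpace.single (e ⟨x, hx⟩) 1, ⟨_, Or.inl rfl⟩, ?_⟩
      rw [hfs, one_smul, hbe]; simp
    · refine ⟨EuclideanSpace.single (e ⟨y, hy⟩) (-1), ⟨_, Or.inr rfl⟩, ?_⟩
      have := hbe (e ⟨y, hy⟩)
      simp only [Equiv.symm_apply_apply] at this
      rw [hfs, neg_one_smul, eq_sub_of_add_eq this]; abel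
  · rintro ⟨_, ⟨i, rfl | rfl⟩, rfl⟩
    · left
      rw [hfs, one_smul, hbe]
      exact (e.symm i).2
    · right
      refine ⟨e.symm i, (e.symm i).2, ?_⟩
      rw [hfs, ← hbe]; module

end Euclidean

/-! ### From congruence classes to side lengths -/

section Congruence
variable {d : ℕ} {P : Finset (EuclideanSpace ℝ (Fin d))}

theorem card_sides {E : Type*} [NormedAddCommGroup E] [InnerProductSpace ℝ E] (x y z : E) :
    (sides x y z).card = 3 := by
  simp [sides]

theorem sides_rotate {E : Type*} [NormedAddCommGroup E] [InnerProductSpace ℝ E] (x y z : E) :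
    sides y z x = sides x y z := by
  simp only [sides, norm_sub_rev z x, norm_sub_rev y x, Multiset.insert_eq_cons,
    ← Multiset.singleton_add]
  abel

theorem sides_swap {E : Type*} [NormedAddCommGroup E] [InnerProductSpace ℝ E] (x y z : E) :
    sides y x z = sides x y z := by
  simp only [sides, norm_sub_rev y x, Multiset.insert_eq_cons, ← Multiset.singleton_add]
  abel

theorem range_fin_three {α : Type*} (t : Fin 3 → α) : Set.range t = {t 0, t 1, t 2} := by
  ext x
  simp [Fin.exists_fin_succ, eq_comm]

theorem injective_of_not_collinear {t : Fin 3 → EuclideanSpace ℝ (Fin d)}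
    (h : ¬ Collinear ℝ (Set.range t)) : Function.Injective t := by
  rw [range_fin_three] at h
  have h01 : t 0 ≠ t 1 := fun e => h (by rw [e]; simpa using collinear_pair ℝ (t 1) (t 2))
  have h12 : t 1 ≠ t 2 := fun e => h (by rw [e]; simpa using collinear_pair ℝ (t 0) (t 2))
  have h02 : t 0 ≠ t 2 := fun e => h (by
    rw [e, Set.insert_comm, Set.pair_eq_singleton]; exact collinear_pair ℝ (t 1) (t 2))
  intro i j hij
  fin_cases i <;> fin_cases j <;> first | rfl | exact absurd hij ‹_› | exact absurd hij.symm ‹_›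

theorem not_collinear_iff_gram {t : Fin 3 → EuclideanSpace ℝ (Fin d)} :
    ¬ Collinear ℝ (Set.range t) ↔ gram (t 1 - t 0) (t 2 - t 0) ≠ 0 := by
  rw [range_fin_three]
  exact not_congr ⟨gram_eq_zero_of_collinear, collinear_of_gram_eq_zero⟩

theorem Congr.sides_eq {s t : Fin 3 → EuclideanSpace ℝ (Fin d)} (hs : Function.Injective s)
    (h : Congr s t) : sides (s 0) (s 1) (s 2) = sides (t 0) (t 1) (t 2) := by
  obtain ⟨φ, hφ⟩ := h
  have h1 : ∀ i, ∃ j, t j = φ (s i) := fun i => by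
    rw [← Set.mem_range, ← hφ]
    exact ⟨_, ⟨i, rfl⟩, rfl⟩
  choose σ hσ using h1
  have hinj : Function.Injective σ := fun i j hij =>
    hs (φ.injective (by rw [← hσ, ← hσ, hij]))
  have hd : ∀ i j, ‖s i - s j‖ = ‖t (σ i) - t (σ j)‖ := fun i j => by
    rw [hσ, hσ, ← dist_eq_norm, ← dist_eq_norm, φ.dist_eq]
  have e : sides (s 0) (s 1) (s 2) = sides (t (σ 0)) (t (σ 1)) (t (σ 2)) := by
    simp only [sides, hd]
  rw [e]
  have n01 : σ 0 ≠ σ 1 := hinj.ne (by decide)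
  have n12 : σ 1 ≠ σ 2 := hinj.ne (by decide)
  have n02 : σ 0 ≠ σ 2 := hinj.ne (by decide)
  generalize σ 0 = i at *
  generalize σ 1 = j at *
  generalize σ 2 = k at *
  have r := sides_rotate (t 0) (t 1) (t 2)
  have r' := sides_rotate (t 1) (t 2) (t 0)
  have w := sides_swap (t 0) (t 1) (t 2)
  have w' := sides_rotate (t 1) (t 0) (t 2)
  have w'' := sides_rotate (t 0) (t 2) (t 1)
  fin_cases i <;> fin_cases j <;> fin_cases k <;> first
    | exact absurd rfl n01
    | exact absurd rfl n12
    | exact absurd rfl n02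
    | rfl
    | exact r
    | exact r'.trans r
    | exact w
    | exact w'.trans w
    | exact w''.trans (w'.trans w)

theorem sides_eq_of_mk_eq {s t : NoncollinearTriple P}
    (h : Quotient.mk (tripleSetoid P) s = Quotient.mk (tripleSetoid P) t) :
    sides (s.1 0) (s.1 1) (s.1 2) = sides (t.1 0) (t.1 1) (t.1 2) := by
  have hc : Congr s.1 t.1 := Quotient.exact h
  exact hc.sides_eq (injective_of_not_collinear s.2.2)

/-- Two triangle classes give two multisets of squared side lengths. -/
theorem exists_hasSides (h : numTriangles P = 2) : ∃ T₁ T₂ : Multiset ℝ, T₁.card = 3 ∧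
    T₂.card = 3 ∧ HasSides P T₁ T₂ ∧ ∃ x ∈ P, ∃ y ∈ P, ∃ z ∈ P, gram (y - x) (z - x) ≠ 0 := by
  obtain ⟨q₁, q₂, -, hq⟩ := Nat.card_eq_two_iff.1 h
  obtain ⟨t₁, rfl⟩ := Quotient.exists_rep q₁
  obtain ⟨t₂, rfl⟩ := Quotient.exists_rep q₂
  refine ⟨sides (t₁.1 0) (t₁.1 1) (t₁.1 2), sides (t₂.1 0) (t₂.1 1) (t₂.1 2), card_sides _ _ _, card_sides _ _ _, ?_,
    _, t₁.2.1 0, _, t₁.2.1 1, _, t₁.2.1 2, not_collinear_iff_gram.1 t₁.2.2⟩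
  intro x hx y hy z hz hg
  have hnc : ¬ Collinear ℝ (Set.range ![x, y, z]) := not_collinear_iff_gram.2 hg
  let t : NoncollinearTriple P := ⟨![x, y, z], by
    intro i; fin_cases i <;> assumption, hnc⟩
  have ht : (Quotient.mk (tripleSetoid P) t : DistinctTriangles P) ∈
      ({Quotient.mk (tripleSetoid P) t₁, Quotient.mk (tripleSetoid P) t₂} :
        Set (DistinctTriangles P)) :=
    hq ▸ Set.mem_univ (α := DistinctTriangles P) _
  have et : sides (t.1 0) (t.1 1) (t.1 2) = sides x y z := by simp [t]
  rw [← et]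
  rcases ht with ht | ht
  · exact Or.inl (sides_eq_of_mk_eq ht)
  · exact Or.inr (sides_eq_of_mk_eq ht)

end Congruence

/-! ### Triangles of the orthoplex -/

section Orthoplex
variable {d : ℕ} {P : Finset (EuclideanSpace ℝ (Fin d))}

theorem exists_isometry_orthonormal {k : ℕ} (hk : k ≤ d)
    {v w : Fin k → EuclideanSpace ℝ (Fin d)} (hv : Orthonormal ℝ v) (hw : Orthonormal ℝ w) :
    ∃ L : EuclideanSpace ℝ (Fin d) ≃ₗᵢ[ℝ] EuclideanSpace ℝ (Fin d), ∀ i, L (v i) = w i := by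
  have ext : ∀ v : Fin k → EuclideanSpace ℝ (Fin d), Orthonormal ℝ v →
      ∃ b : OrthonormalBasis (Fin d) ℝ (EuclideanSpace ℝ (Fin d)),
        ∀ i, b (Fin.castLE hk i) = v i := by
    intro v hv
    obtain ⟨b, hb⟩ := Orthonormal.exists_orthonormalBasis_extension_of_card_eq (𝕜 := ℝ)
      (ι := Fin d) (E := EuclideanSpace ℝ (Fin d)) (by simp) (s := {i | (i : ℕ) < k})
      (v := fun i => if h : (i : ℕ) < k then v ⟨i, h⟩ else 0) (by
        have := hv.comp (fun i : {i : Fin d | (i : ℕ) < k} => (⟨i, i.2⟩ : Fin k)) (by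
          intro i j hij
          simpa [Subtype.ext_iff, Fin.ext_iff] using hij)
        refine (congrArg (Orthonormal ℝ) (funext fun i => ?_)).mp this
        have hi : (i : ℕ) < k := i.2
        simp [hi])
    exact ⟨b, fun i => by rw [hb _ (by simp)]; simp⟩
  obtain ⟨b, hb⟩ := ext v hv
  obtain ⟨b', hb'⟩ := ext w hw
  refine ⟨b.equiv b' (Equiv.refl _), fun i => ?_⟩
  rw [← hb, ← hb', OrthonormalBasis.equiv_apply_basis, Equiv.refl_apply]

/-- An isometry conjugated by a similarity is an isometry. -/
theorem exists_conj (f : EuclideanSpace ℝ (Fin d) ≃ᵈ EuclideanSpace ℝ (Fin d))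
    (L : EuclideanSpace ℝ (Fin d) ≃ₗᵢ[ℝ] EuclideanSpace ℝ (Fin d)) :
    ∃ φ : EuclideanSpace ℝ (Fin d) ≃ᵢ EuclideanSpace ℝ (Fin d), ∀ x, φ (f x) = f (L x) := by
  refine ⟨⟨f.toEquiv.symm.trans (L.toEquiv.trans f.toEquiv), ?_⟩, fun x => ?_⟩
  · refine Isometry.of_dist_eq fun x y => ?_
    obtain ⟨x, rfl⟩ := f.surjective x
    obtain ⟨y, rfl⟩ := f.surjective y
    have : ∀ z, (f.toEquiv.symm.trans (L.toEquiv.trans f.toEquiv)) (f z) = f (L z) := fun z => by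
      change f (L (f.symm (f z))) = _
      rw [DilationEquiv.symm_apply_apply]
    rw [Equiv.toFun_as_coe, this, this, Dilation.dist_eq f, Dilation.dist_eq f, L.isometry.dist_eq]
  · change f (L (f.symm (f x))) = _
    rw [DilationEquiv.symm_apply_apply]

theorem norm_of_mem_stdOrthoplex {x : EuclideanSpace ℝ (Fin d)} (hx : x ∈ stdOrthoplex d) :
    ‖x‖ = 1 := by
  obtain ⟨i, rfl | rfl⟩ := hx <;> simp

theorem neg_or_orthogonal {x y : EuclideanSpace ℝ (Fin d)} (hx : x ∈ stdOrthoplex d)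
    (hy : y ∈ stdOrthoplex d) (hxy : x ≠ y) : x = -y ∨ ⟪x, y⟫ = 0 := by
  obtain ⟨i, hi⟩ := hx
  obtain ⟨j, hj⟩ := hy
  by_cases hij : i = j
  · subst hij
    left
    have : EuclideanSpace.single i (-1 : ℝ) = -EuclideanSpace.single i (1 : ℝ) := by
      ext k; by_cases hk : k = i <;> simp [hk]
    rcases hi with rfl | rfl <;> rcases hj with rfl | rfl <;> simp_all
  · right
    rcases hi with rfl | rfl <;> rcases hj with rfl | rfl <;>
      simp [EuclideanSpace.inner_single_left, hij]

theorem card_of_isOrthoplex (h : IsOrthoplex P) : P.card = 2 * d := by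
  obtain ⟨f, hf⟩ := h
  let g : Fin d × Bool → EuclideanSpace ℝ (Fin d) :=
    fun p => f (EuclideanSpace.single p.1 (if p.2 then 1 else -1))
  have hg : (P : Set _) = Set.range g := by
    rw [hf]
    ext x
    constructor
    · rintro ⟨_, ⟨i, rfl | rfl⟩, rfl⟩
      · exact ⟨(i, true), by simp [g]⟩
      · exact ⟨(i, false), by simp [g]⟩
    · rintro ⟨⟨i, b⟩, rfl⟩
      cases b
      · exact ⟨_, ⟨i, Or.inr rfl⟩, by simp [g]⟩
      · exact ⟨_, ⟨i, Or.inl rfl⟩, by simp [g]⟩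
  have hinj : Function.Injective g := by
    rintro ⟨i, b⟩ ⟨j, b'⟩ hij
    have hij := f.injective hij
    have h1 := congrArg (fun x : EuclideanSpace ℝ (Fin d) => x i) hij
    by_cases e : i = j
    · subst e
      cases b <;> cases b' <;> norm_num at h1 <;> simp
    · cases b <;> cases b' <;> simp [e] at h1
  rw [← Set.ncard_coe_finset, hg, Set.ncard_range_of_injective hinj]
  simp [mul_comm]

theorem orthonormal_pair {E : Type*} [NormedAddCommGroup E] [InnerProductSpace ℝ E] {x y : E}
    (hx : ‖x‖ = 1) (hy : ‖y‖ = 1) (hxy : ⟪x, y⟫ = 0) : Orthonormal ℝ ![x, y] := by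
  refine ⟨fun i => by fin_cases i <;> simpa, fun i j hij => ?_⟩
  fin_cases i <;> fin_cases j <;> first | exact absurd rfl hij | skip
  · exact hxy
  · simpa [real_inner_comm] using hxy

/-- The vertices of an orthoplex form two congruence classes of triangles: three pairwise
orthogonal vertices, or two opposite vertices and a third one. -/
theorem numTriangles_of_isOrthoplex (hd : 3 ≤ d) (h : IsOrthoplex P) : numTriangles P = 2 := by
  obtain ⟨f, hf⟩ := h
  have memP : ∀ x, f x ∈ P ↔ x ∈ stdOrthoplex d := fun x => by
    rw [← Finset.mem_coe, hf, f.injective.mem_set_image]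
  set r : ℝ := (Dilation.ratio f : ℝ) with hr
  have hr0 : 0 < r := by exact_mod_cast Dilation.ratio_pos f
  have hdist : ∀ x y, ‖f x - f y‖ ^ 2 = r ^ 2 * ‖x - y‖ ^ 2 := fun x y => by
    rw [← dist_eq_norm, Dilation.dist_eq, dist_eq_norm, mul_pow]
  have horth : ∀ x y : EuclideanSpace ℝ (Fin d), ‖x‖ = 1 → ‖y‖ = 1 → ⟪x, y⟫ = 0 →
      ‖f x - f y‖ ^ 2 = 2 * r ^ 2 := fun x y hx hy hxy => by
    rw [hdist, norm_sub_sq_real, hx, hy, hxy]; ring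
  let a : EuclideanSpace ℝ (Fin d) := EuclideanSpace.single ⟨0, by omega⟩ 1
  let a' : EuclideanSpace ℝ (Fin d) := EuclideanSpace.single ⟨0, by omega⟩ (-1)
  let b : EuclideanSpace ℝ (Fin d) := EuclideanSpace.single ⟨1, by omega⟩ 1
  let c : EuclideanSpace ℝ (Fin d) := EuclideanSpace.single ⟨2, by omega⟩ 1
  have ha : ‖a‖ = 1 := by simp [a]
  have hb : ‖b‖ = 1 := by simp [b]
  have hc : ‖c‖ = 1 := by simp [c]
  have ha' : a' = -a := by
    ext k; by_cases hk : k = ⟨0, by omega⟩ <;> simp [a, a', hk]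
  have hab : ⟪a, b⟫ = 0 := by simp [a, b, EuclideanSpace.inner_single_left]
  have hbc : ⟪b, c⟫ = 0 := by simp [b, c, EuclideanSpace.inner_single_left]
  have hac : ⟪a, c⟫ = 0 := by simp [a, c, EuclideanSpace.inner_single_left]
  have ho3 : Orthonormal ℝ ![a, b, c] := by
    refine ⟨fun i => by fin_cases i <;> simpa, fun i j hij => ?_⟩
    fin_cases i <;> fin_cases j <;> first
      | exact absurd rfl hij
      | assumption
      | (rw [real_inner_comm]; assumption)
  have s1 : sides (f a) (f b) (f c) = {2 * r ^ 2, 2 * r ^ 2, 2 * r ^ 2} := by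
    rw [sides, horth a b ha hb hab, horth b c hb hc hbc, horth a c ha hc hac]
  have s2 : sides (f a) (f a') (f b) = {4 * r ^ 2, 2 * r ^ 2, 2 * r ^ 2} := by
    rw [sides, horth a b ha hb hab, horth a' b (by rw [ha', norm_neg, ha]) hb
      (by rw [ha', inner_neg_left, hab, neg_zero]), hdist, ha', sub_neg_eq_add, ← two_smul ℝ a,
      norm_smul, ha]
    norm_num [mul_comm]
  have n1 : ¬ Collinear ℝ (Set.range ![f a, f b, f c]) := by
    rw [not_collinear_iff_gram]
    change gram (f b - f a) (f c - f a) ≠ 0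
    rw [gram_eq_sides, horth a b ha hb hab, horth b c hb hc hbc, horth a c ha hc hac]
    ring_nf
    positivity
  have n2 : ¬ Collinear ℝ (Set.range ![f a, f a', f b]) := by
    rw [not_collinear_iff_gram]
    change gram (f a' - f a) (f b - f a) ≠ 0
    rw [gram_eq_sides, horth a b ha hb hab, horth a' b (by rw [ha', norm_neg, ha]) hb
      (by rw [ha', inner_neg_left, hab, neg_zero]), hdist, ha', sub_neg_eq_add, ← two_smul ℝ a,
      norm_smul, ha]
    norm_num
    ring_nf
    positivity
  let t₁ : NoncollinearTriple P := ⟨![f a, f b, f c], by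
    intro i
    fin_cases i
    · exact (memP a).2 ⟨_, Or.inl rfl⟩
    · exact (memP b).2 ⟨_, Or.inl rfl⟩
    · exact (memP c).2 ⟨_, Or.inl rfl⟩, n1⟩
  let t₂ : NoncollinearTriple P := ⟨![f a, f a', f b], by
    intro i
    fin_cases i
    · exact (memP a).2 ⟨_, Or.inl rfl⟩
    · exact (memP a').2 ⟨_, Or.inr rfl⟩
    · exact (memP b).2 ⟨_, Or.inl rfl⟩, n2⟩
  refine Nat.card_eq_two_iff.2 ⟨Quotient.mk (tripleSetoid P) t₁, Quotient.mk (tripleSetoid P) t₂,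
    fun e => ?_, ?_⟩
  · have e' : sides (f a) (f b) (f c) = sides (f a) (f a') (f b) :=
      by simpa [t₁, t₂] using sides_eq_of_mk_eq e
    rw [s1, s2] at e'
    have := triple_sum e'
    nlinarith
  rw [Set.eq_univ_iff_forall]
  intro q
  obtain ⟨⟨t, htP, htn⟩, rfl⟩ := Quotient.exists_rep q
  have hinj := injective_of_not_collinear htn
  obtain ⟨s, rfl⟩ : ∃ s : Fin 3 → EuclideanSpace ℝ (Fin d), t = f ∘ s :=
    ⟨f.symm ∘ t, by ext1 i; simp⟩
  have hs : ∀ i, s i ∈ stdOrthoplex d := fun i => (memP _).1 (htP i)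
  have hsn : ∀ i, ‖s i‖ = 1 := fun i => norm_of_mem_stdOrthoplex (hs i)
  have hsi : Function.Injective s := hinj.of_comp
  by_cases hall : ∀ i j, i ≠ j → ⟪s i, s j⟫ = 0
  · left
    obtain ⟨L, hL⟩ := exists_isometry_orthonormal hd (v := s) ⟨hsn, fun i j => hall i j⟩ ho3
    obtain ⟨φ, hφ⟩ := exists_conj f L
    refine Quotient.sound ⟨φ, ?_⟩
    change φ '' Set.range (f ∘ s) = Set.range ![f a, f b, f c]
    rw [← Set.range_comp]
    congr 1
    ext1 i
    simp only [Function.comp_apply, hφ, hL]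
    fin_cases i <;> rfl
  · right
    push Not at hall
    obtain ⟨i, j, hij, hne⟩ := hall
    have hneg := (neg_or_orthogonal (hs i) (hs j) (hsi.ne hij)).resolve_right hne
    obtain ⟨k, hki, hkj, hrange⟩ : ∃ k, k ≠ i ∧ k ≠ j ∧ ∀ l, l = i ∨ l = j ∨ l = k := by
      clear hneg hne
      revert i j
      decide
    have hjk : ⟪s j, s k⟫ = 0 := by
      rcases neg_or_orthogonal (hs j) (hs k) (hsi.ne hkj.symm) with e | e
      · exact absurd (hsi (by rw [hneg, e, neg_neg])) hki.symm
      · exact e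
    obtain ⟨L, hL⟩ := exists_isometry_orthonormal (by omega : 2 ≤ d)
      (orthonormal_pair (hsn j) (hsn k) hjk) (orthonormal_pair ha hb hab)
    have hLj : L (s j) = a := hL 0
    have hLk : L (s k) = b := hL 1
    have hLi : L (s i) = a' := by rw [hneg, map_neg, hLj, ha']
    obtain ⟨φ, hφ⟩ := exists_conj f L
    refine Quotient.sound ⟨φ, ?_⟩
    change φ '' Set.range (f ∘ s) = Set.range ![f a, f a', f b]
    rw [← Set.range_comp, range_fin_three ![f a, f a', f b]]
    apply Set.Subset.antisymm
    · rintro _ ⟨l, rfl⟩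
      simp only [Function.comp_apply, hφ]
      rcases hrange l with rfl | rfl | rfl
      · rw [hLi]; simp
      · rw [hLj]; simp
      · rw [hLk]; simp
    · rintro x (rfl | rfl | rfl)
      · exact ⟨j, by simp [hφ, hLj]⟩
      · exact ⟨i, by simp [hφ, hLi]⟩
      · exact ⟨k, by simp [hφ, hLk]⟩

theorem exists_isOrthoplex (d : ℕ) : ∃ P : Finset (EuclideanSpace ℝ (Fin d)), IsOrthoplex P := by
  have hfin : (stdOrthoplex d).Finite := by
    have : stdOrthoplex d = ⋃ i : Fin d,
        {EuclideanSpace.single i (1 : ℝ), EuclideanSpace.single i (-1 : ℝ)} := by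
      ext x; simp [stdOrthoplex]
    rw [this]
    exact Set.finite_iUnion fun i => Set.toFinite _
  exact ⟨hfin.toFinset, DilationEquiv.refl _, by simp⟩

/-- A set with two triangle classes and at least `2 * d` points is an orthoplex. -/
theorem card_eq_and_isOrthoplex (hd : 3 ≤ d) (h : numTriangles P = 2) (hP : 2 * d ≤ P.card) :
    P.card = 2 * d ∧ IsOrthoplex P := by
  obtain ⟨T₁, T₂, hT₁, hT₂, hs, hnd⟩ := exists_hasSides h
  obtain ⟨o, ρ, hρ, hc⟩ := hs.exists_isCross hT₁ hT₂ hnd (by omega) (by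
    rw [finrank_euclideanSpace_fin]; omega)
  obtain ⟨h1, h2⟩ := hc.card_le hρ
  have : P.card = 2 * d := by omega
  exact ⟨this, h2 this⟩

end Orthoplex

end TwoTriangles

theorem theorem1 (d : ℕ) (hd : 3 ≤ d) :
    IsGreatest {n : ℕ | ∃ P : Finset (EuclideanSpace ℝ (Fin d)),
        P.card = n ∧ TwoTriangles.numTriangles P = 2} (2 * d) ∧
      ∀ P : Finset (EuclideanSpace ℝ (Fin d)),
        (P.card = 2 * d ∧ TwoTriangles.numTriangles P = 2) ↔ TwoTriangles.IsOrthoplex P := by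
  refine ⟨⟨?_, ?_⟩, fun P => ⟨?_, ?_⟩⟩
  · obtain ⟨P, hP⟩ := TwoTriangles.exists_isOrthoplex d
    exact ⟨P, TwoTriangles.card_of_isOrthoplex hP, TwoTriangles.numTriangles_of_isOrthoplex hd hP⟩
  · rintro n ⟨P, rfl, hP⟩
    by_contra! hn
    have := (TwoTriangles.card_eq_and_isOrthoplex hd hP hn.le).1
    omega
  · rintro ⟨hc, hP⟩
    exact (TwoTriangles.card_eq_and_isOrthoplex hd hP hc.ge).2
  · intro hP
    exact ⟨TwoTriangles.card_of_isOrthoplex hP, TwoTriangles.numTriangles_of_isOrthoplex hd hP⟩
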